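/- Let $K$ be a number field that is Galois over $\mathbb{Q}$ with cyclic Galois group generated by $\sigma$. Let $\mathfrak o$ be its ring of integers, $U=\mathfrak o^\times$, and let $\mathcal N$ be the group of elements $\beta\in K^\times$ with $N_{K/\mathbb{Q}}(\beta)=1$. Let $\log:K^\times\to\mathbb{R}^{r_1+r_2}$ be $\alpha\mapsto(\log\|\alpha\|_v)_v$, with $v$ running over the archimedean places and $\|\cdot\|_v$ the usual absolute value if $v$ is real and its square if $v$ is complex. Let $\Sigma(\mathbf x)=x_1+\dots+x_{r_1+r_2}$ and let $T=\ker\Sigma/\log U$, a torus of dimension $r_1+r_2-1$, with Haar probability measure $\mu$. For $\beta\in\mathcal N$ write $\widetilde\beta=\log\beta+\log U\in T$. Put $\pi(\alpha)=\alpha/\sigma(\alpha)$. A visible point for $\beta\in\mathcal N$ is a non-zero $\alpha\in\mathfrak o$ with $\pi(\alpha)=\beta$ for which $|N_{K/\mathbb{Q}}(\alpha)|$ is minimal among all non-zero integers with this property, and the height of $\beta$ is $h(\beta)=|N_{K/\mathbb{Q}}(\alpha)|$. Both $h(\beta)$ and $\widetilde\beta$ depend only on the class of $\beta$ in $\mathcal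 N/\pi(U)$. Let $\widetilde{\mathcal N}$ denote the family of points $\widetilde\beta\in T$ indexed by the classes $[\beta]\in\mathcal N/\pi(U)$ (so a point of $T$ is counted once for each class above it), ordered by $h$. Then every $\beta\in\mathcal N$ has a visible point; for every real $r$ the set $\mathcal C(r)=\{[\beta]\in\mathcal N/\pi(U):h(\beta)<r\}$ is finite; and $\widetilde{\mathcal N}$, ordered by $h$, is equidistributed in $T$: for every continuous character $\chi:T\to\mathbb{T}$ (where $\mathbb{T}$ is the unit circle), $$\lim_{r\to\infty}\frac{1}{\#\mathcal C(r)}\sum_{[\beta]\in\mathcal C(r)}\chi(\widetilde\beta)=\int_T\chi\,d\mu ,$$ and in particular this limit is $0$ for every non-trivial $\chi$. -/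

import Mathlib

open NumberField Filter Topology

namespace CyclicNormOne

noncomputable section

/-- The regulator map `x ↦ (log ‖x‖_v)_v` on `Kˣ`, `v` running over the archimedean places, where
`‖x‖_v` is the usual absolute value at a real place and its square at a complex place. -/
def logMap (K : Type*) [Field K] [NumberField K] :
    Additive Kˣ →+ (InfinitePlace K → ℝ) where
  toFun x v := v.mult * Real.log (v (x.toMul : K))
  map_zero' := by ext v; simp
  map_add' x y := by
    ext v
    simp [Real.log_mul, mul_add]

/-- The hyperplane `ker Σ` of vectors whose coordinates sum to zero. -/
def kerSum (K : Type*) [Field K] [NumberField K] : Submodule ℝ (InfinitePlace K → ℝ) :=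
  LinearMap.ker (∑ v : InfinitePlace K, LinearMap.proj (R := ℝ) (φ := fun _ => ℝ) v)

lemma mem_kerSum {K : Type*} [Field K] [NumberField K] (x : InfinitePlace K → ℝ) :
    x ∈ kerSum K ↔ ∑ v, x v = 0 := by
  simp [kerSum]

/-- The group of units `U` of the ring of integers, as a subgroup of `Kˣ`. -/
def unitGroup (K : Type*) [Field K] [NumberField K] : Subgroup Kˣ :=
  (Units.map (algebraMap (𝓞 K) K : 𝓞 K →* K)).range

/-- `log U`, as a subgroup of `ker Σ`. -/
def logUnits (K : Type*) [Field K] [NumberField K] : AddSubgroup (kerSum K) :=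
  ((unitGroup K).toAddSubgroup.map (logMap K)).comap (kerSum K).toAddSubgroup.subtype

/-- The torus `T = ker Σ / log U`, with the quotient topology. -/
def Torus (K : Type*) [Field K] [NumberField K] : Type _ := kerSum K ⧸ logUnits K

instance (K : Type*) [Field K] [NumberField K] : AddCommGroup (Torus K) :=
  inferInstanceAs (AddCommGroup (kerSum K ⧸ logUnits K))

instance (K : Type*) [Field K] [NumberField K] : TopologicalSpace (Torus K) :=
  inferInstanceAs (TopologicalSpace (kerSum K ⧸ logUnits K))

instance (K : Type*) [Field K] [NumberField K] : IsTopologicalAddGroup (Torus K) :=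
  inferInstanceAs (IsTopologicalAddGroup (kerSum K ⧸ logUnits K))

instance (K : Type*) [Field K] [NumberField K] : MeasurableSpace (Torus K) := borel _

instance (K : Type*) [Field K] [NumberField K] : BorelSpace (Torus K) := ⟨rfl⟩

/-- The quotient map `ker Σ → T`. -/
def Torus.mk (K : Type*) [Field K] [NumberField K] : kerSum K →+ Torus K :=
  QuotientAddGroup.mk' (logUnits K)

lemma Torus.mk_eq_zero {K : Type*} [Field K] [NumberField K] (x : kerSum K) :
    Torus.mk K x = 0 ↔ ∃ u ∈ unitGroup K, logMap K (Additive.ofMul u) = x := by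
  refine (QuotientAddGroup.eq_zero_iff x).trans ?_
  rfl

open scoped Classical in
/-- A vector of `ker Σ` is determined by its coordinates at all places but one. -/
def ofLogSpace {K : Type*} [Field K] [NumberField K] (y : Units.dirichletUnitTheorem.logSpace K) : kerSum K :=
  ⟨fun w => if h : w ≠ Units.dirichletUnitTheorem.w₀ then y ⟨w, h⟩ else - ∑ i, y i, by
    rw [mem_kerSum, Fintype.sum_eq_add_sum_subtype_ne _ Units.dirichletUnitTheorem.w₀,
      dif_neg (by simp), neg_add_eq_zero]
    refine Finset.sum_congr rfl fun i _ => ?_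
    rw [dif_pos i.2]⟩

/-- Compactness of `T`, a form of Dirichlet's unit theorem. -/
instance (K : Type*) [Field K] [NumberField K] : CompactSpace (Torus K) := by
  classical
  let b := (Units.basisUnitLattice K).ofZLatticeBasis ℝ
  have hcont : Continuous (fun y : Units.dirichletUnitTheorem.logSpace K => Torus.mk K (ofLogSpace y)) := by
    have h1 : Continuous (ofLogSpace (K := K)) := by
      refine Continuous.subtype_mk (continuous_pi fun w => ?_) _
      split_ifs <;> fun_prop
    exact (continuous_quot_mk (r := _)).comp h1
  refine ⟨?_⟩
  have himg := (isCompact_closedBall (0 : Units.dirichletUnitTheorem.logSpace K) (∑ i, ‖b i‖)).image hcont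
  convert himg
  symm
  rw [Set.eq_univ_iff_forall]
  intro t
  obtain ⟨x, rfl⟩ := QuotientAddGroup.mk'_surjective (logUnits K) t
  let y : Units.dirichletUnitTheorem.logSpace K := fun w => x.1 w.1
  refine ⟨ZSpan.fract b y, by simpa using ZSpan.norm_fract_le b y, ?_⟩
  have hfl : ((ZSpan.floor b y : Submodule.span ℤ (Set.range b)) : Units.dirichletUnitTheorem.logSpace K) ∈
      Units.unitLattice K := by
    exact (Module.Basis.ofZLatticeBasis_span ℝ (L := Units.unitLattice K)
      (Units.basisUnitLattice K)).le (ZSpan.floor b y).2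
  obtain ⟨u, -, hu⟩ := hfl
  change Torus.mk K _ = Torus.mk K x
  rw [eq_comm, ← sub_eq_zero, ← map_sub, Torus.mk_eq_zero]
  refine ⟨Units.map (algebraMap (𝓞 K) K : 𝓞 K →* K) u.toMul, ⟨_, rfl⟩, ?_⟩
  have key : ∀ w (hw : w ≠ Units.dirichletUnitTheorem.w₀),
      (w.mult : ℝ) * Real.log (w ((u.toMul : 𝓞 K) : K)) =
        y ⟨w, hw⟩ - ZSpan.fract b y ⟨w, hw⟩ := by
    intro w hw
    have := congrFun hu ⟨w, hw⟩
    rw [ZSpan.fract_apply]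
    simp only [Pi.sub_apply, sub_sub_cancel]
    exact this
  have hs1 := Units.sum_mult_mul_log u.toMul
  have hs2 := (mem_kerSum _).1 (x - ofLogSpace (ZSpan.fract b y)).2
  rw [Fintype.sum_eq_add_sum_subtype_ne _ Units.dirichletUnitTheorem.w₀] at hs1 hs2
  have hne : ∀ w (hw : w ≠ Units.dirichletUnitTheorem.w₀),
      (x - ofLogSpace (ZSpan.fract b y)).1 w =
        (w.mult : ℝ) * Real.log (w ((u.toMul : 𝓞 K) : K)) := by
    intro w hw
    rw [key w hw]
    change x.1 w - (ofLogSpace (ZSpan.fract b y)).1 w = _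
    simp [ofLogSpace, hw, y]
  ext w
  change (w.mult : ℝ) * Real.log (w ((u.toMul : 𝓞 K) : K)) = _
  by_cases hw : w = Units.dirichletUnitTheorem.w₀
  · subst hw
    have hsum : ∑ i : {w : InfinitePlace K // w ≠ Units.dirichletUnitTheorem.w₀},
        (x - ofLogSpace (ZSpan.fract b y)).1 i.1 =
        ∑ i : {w : InfinitePlace K // w ≠ Units.dirichletUnitTheorem.w₀},
          (i.1.mult : ℝ) * Real.log (i.1 ((u.toMul : 𝓞 K) : K)) :=
      Finset.sum_congr rfl fun i _ => hne i.1 i.2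
    linarith
  · exact (hne w hw).symm

/-- The Haar probability measure on `T`. -/
def haarTorus (K : Type*) [Field K] [NumberField K] : MeasureTheory.Measure (Torus K) :=
  MeasureTheory.Measure.addHaarMeasure ⊤

/-- The group `𝒩` of elements of `K` of norm one over `ℚ`. -/
def normOne (K : Type*) [Field K] [NumberField K] : Subgroup Kˣ :=
  (Units.map (Algebra.norm ℚ : K →* ℚ)).ker

lemma mem_normOne {K : Type*} [Field K] [NumberField K] (x : Kˣ) :
    x ∈ normOne K ↔ Algebra.norm ℚ (x : K) = 1 := by
  simp [normOne, MonoidHom.mem_ker, Units.ext_iff]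

/-- The homomorphism `π : Kˣ → 𝒩`, `α ↦ α / σ(α)`. -/
def piMap {K : Type*} [Field K] [NumberField K] (σ : K ≃ₐ[ℚ] K) : Kˣ →* normOne K where
  toFun a := ⟨a / Units.map (σ : K →* K) a, by
    have h : Algebra.norm ℚ ((Units.map (σ : K →* K) a : Kˣ) : K) = Algebra.norm ℚ (a : K) :=
      Algebra.norm_eq_of_algEquiv σ (a : K)
    have h2 : Units.map (Algebra.norm ℚ : K →* ℚ) (Units.map (σ : K →* K) a) =
        Units.map (Algebra.norm ℚ : K →* ℚ) a := Units.ext h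
    rw [normOne, MonoidHom.mem_ker, map_div, h2, div_self']⟩
  map_one' := by ext; simp
  map_mul' a b := by
    ext
    simp [mul_div_mul_comm]

/-- The non-zero algebraic integers `α` with `α / σ(α) = β`. -/
def integralSolutions {K : Type*} [Field K] [NumberField K] (σ : K ≃ₐ[ℚ] K) (β : normOne K) :
    Set (𝓞 K) :=
  {α | α ≠ 0 ∧ (α : K) / σ (α : K) = ((β : Kˣ) : K)}

/-- `α` is a visible point for `β`: it is a non-zero integer with `α / σ(α) = β`, and `|N(α)|` is
minimal among all such integers. -/
def IsVisiblePoint {K : Type*} [Field K] [NumberField K] (σ : K ≃ₐ[ℚ] K) (β : normOne K)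
    (α : 𝓞 K) : Prop :=
  α ∈ integralSolutions σ β ∧
    ∀ γ ∈ integralSolutions σ β, (Algebra.norm ℤ α).natAbs ≤ (Algebra.norm ℤ γ).natAbs

/-- The height `h(β)`: the minimum of `|N(α)|` over the non-zero integers `α` with
`α / σ(α) = β`, that is, `|N(α)|` for any visible point `α` for `β`. -/
def height {K : Type*} [Field K] [NumberField K] (σ : K ≃ₐ[ℚ] K) (β : normOne K) : ℕ :=
  sInf ((fun α : 𝓞 K => (Algebra.norm ℤ α).natAbs) '' integralSolutions σ β)

lemma height_eq {K : Type*} [Field K] [NumberField K] {σ : K ≃ₐ[ℚ] K} {β : normOne K}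
    {α : 𝓞 K} (h : IsVisiblePoint σ β α) : height σ β = (Algebra.norm ℤ α).natAbs := by
  refine le_antisymm (Nat.sInf_le ⟨α, h.1, rfl⟩) (le_csInf ⟨_, α, h.1, rfl⟩ ?_)
  rintro _ ⟨γ, hγ, rfl⟩
  exact h.2 γ hγ

/-- `π(U)`: the norm-one elements `u / σ(u)` with `u` a unit. -/
def piUnits {K : Type*} [Field K] [NumberField K] (σ : K ≃ₐ[ℚ] K) : Subgroup (normOne K) :=
  (unitGroup K).map (piMap σ)

lemma height_mul_le {K : Type*} [Field K] [NumberField K] (σ : K ≃ₐ[ℚ] K) (β : normOne K)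
    {w : normOne K} (hw : w ∈ piUnits σ) :
    (fun α : 𝓞 K => (Algebra.norm ℤ α).natAbs) '' integralSolutions σ β ⊆
      (fun α : 𝓞 K => (Algebra.norm ℤ α).natAbs) '' integralSolutions σ (β * w) := by
  obtain ⟨_, ⟨u, rfl⟩, rfl⟩ := hw
  rintro _ ⟨α, ⟨h0, hα⟩, rfl⟩
  refine ⟨α * u, ⟨mul_ne_zero h0 u.ne_zero, ?_⟩, ?_⟩
  · simp [piMap, ← hα, mul_div_mul_comm]
  · have hu : (Algebra.norm ℤ (u : 𝓞 K)).natAbs = 1 :=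
      Int.isUnit_iff_natAbs_eq.1 (u.isUnit.map (Algebra.norm ℤ))
    simp [Int.natAbs_mul, hu]

lemma height_mul {K : Type*} [Field K] [NumberField K] (σ : K ≃ₐ[ℚ] K) (β : normOne K)
    {w : normOne K} (hw : w ∈ piUnits σ) : height σ (β * w) = height σ β := by
  refine congrArg sInf (Set.Subset.antisymm ?_ (height_mul_le σ β hw))
  simpa using height_mul_le σ (β * w) (inv_mem hw)

/-- The classes of norm-one elements modulo `π(U)`. The height and the map to `T` are both
well defined on these classes. -/
abbrev NormOneClass {K : Type*} [Field K] [NumberField K] (σ : K ≃ₐ[ℚ] K) : Type _ :=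
  normOne K ⧸ piUnits σ

/-- The height of a class of norm-one elements. -/
def classHeight {K : Type*} [Field K] [NumberField K] (σ : K ≃ₐ[ℚ] K) (x : NormOneClass σ) : ℕ :=
  Quotient.liftOn' x (height σ) fun a b hab => by
    have := height_mul σ a (QuotientGroup.leftRel_apply.1 hab)
    simpa using this.symm

lemma logMap_mem_kerSum {K : Type*} [Field K] [NumberField K] (β : normOne K) :
    logMap K (Additive.ofMul (β : Kˣ)) ∈ kerSum K := by
  rw [mem_kerSum]
  have h := InfinitePlace.prod_eq_abs_norm ((β : Kˣ) : K)
  rw [(mem_normOne _).1 β.2] at h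
  have h2 := congrArg Real.log h
  rw [Real.log_prod (fun w _ => pow_ne_zero _ (by simp))] at h2
  simpa [logMap, Real.log_pow] using h2

/-- The map `𝒩 → T`, `β ↦ log β + log U`. -/
def tilde {K : Type*} [Field K] [NumberField K] (β : normOne K) : Torus K :=
  Torus.mk K ⟨logMap K (Additive.ofMul (β : Kˣ)), logMap_mem_kerSum β⟩

lemma tilde_mul {K : Type*} [Field K] [NumberField K] (β γ : normOne K) :
    tilde (β * γ) = tilde β + tilde γ := by
  rw [tilde, tilde, tilde, ← map_add]
  congr 1
  ext1
  simp

lemma tilde_piUnits {K : Type*} [Field K] [NumberField K] (σ : K ≃ₐ[ℚ] K)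
    {w : normOne K} (hw : w ∈ piUnits σ) : tilde w = 0 := by
  obtain ⟨_, ⟨u, rfl⟩, rfl⟩ := hw
  rw [tilde, Torus.mk_eq_zero]
  refine ⟨_, ⟨u / Units.map (RingOfIntegers.mapRingEquiv (σ : K ≃+* K) : 𝓞 K →* 𝓞 K) u, rfl⟩, ?_⟩
  simp only [map_div]
  rfl

/-- The map from classes of norm-one elements to `T`, whose image is `log 𝒩 / log U`. -/
def classTilde {K : Type*} [Field K] [NumberField K] (σ : K ≃ₐ[ℚ] K) (x : NormOneClass σ) :
    Torus K :=
  Quotient.liftOn' x tilde fun a b hab => by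
    have h := tilde_piUnits σ (QuotientGroup.leftRel_apply.1 hab)
    have h2 := tilde_mul a (a⁻¹ * b)
    rw [h, mul_inv_cancel_left] at h2
    simpa using h2.symm

/-- The classes of height less than `r`. -/
def classesBelow {K : Type*} [Field K] [NumberField K] (σ : K ≃ₐ[ℚ] K) (r : ℝ) :
    Set (NormOneClass σ) :=
  {x | (classHeight σ x : ℝ) < r}

/-- The average of a character `χ` of `T` over the classes of height less than `r`. -/
def average {K : Type*} [Field K] [NumberField K] (σ : K ≃ₐ[ℚ] K) (χ : AddChar (Torus K) Circle)
    (r : ℝ) : ℂ :=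
  (∑ᶠ x ∈ classesBelow σ r, (χ (classTilde σ x) : ℂ)) / ((classesBelow σ r).ncard : ℂ)

end

end CyclicNormOne

/-! By Hilbert 90 every norm-one `β` is `α / σ(α)` with `α` integral
(`exists_div_eq_of_norm_eq_one`). Two solutions differ by a factor fixed by `σ`, hence rational, so
the integral solutions are exactly the non-zero integer multiples of a visible point
(`IsVisiblePoint.exists_eq_intCast_mul`). Modulo units, pairs (class, positive integer `n`)
therefore correspond to non-zero principal ideals, of norm `h * n ^ d` with `d = [K : ℚ]`
(`multipleIdealEquiv`). Sums over classes thus reduce to sums over principal ideals.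

Through `α ↦ α / σ(α)`, a character `χ` of the torus becomes a unit-invariant, multiplicative
function of degree zero on the elements of non-zero norm of the mixed space (`mixedChar`). Since `1
- σ` is surjective on `ker Σ`, a non-trivial `χ` stays non-trivial on elements of norm one. The sum
of `χ` over principal ideals of norm at most `n ^ d` is, up to the number of roots of unity, a sum
over lattice points in the dilated fundamental cone. After a cutoff near norm zero it is a Riemann
sum, whose limit is an integral over `normLeOne K`. Multiplication by a norm-one `z` preserves Haar
measure and moves the cone to another fundamental domain, so this integral equals itself times `χ(z)
≠ 1` and vanishes (`setIntegral_cutoffChar_eq_zero`). Hence the sum over ideals of norm at most `N`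
is `o(N)`, while their number is asymptotic to `b * N` with `b ≠ 0`.

Möbius inversion in `n` removes the multiples (`tendsto_div_of_sum_div_pow`): the character sum over
classes is `o(N)`, and the number of classes is asymptotic to `(b / ζ(d)) * N`. The inversion needs
`d ≥ 2`, which is automatic because the torus is trivial for `d = 1`. -/

namespace CyclicNormOne

/-! ### Möbius inversion over `d`-th powers and its asymptotics. -/

/-- The sum of the Möbius function over `n` weighted by `n⁻ᵈ`. -/
noncomputable def moebiusSeries (d : ℕ) : ℂ :=
  ∑' n : ℕ, (ArithmeticFunction.moebius n : ℂ) / (n : ℂ) ^ d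

/-- The series is `1 / ζ(d)`: its product with the zeta series is `1`. -/
lemma moebiusSeries_ne_zero {d : ℕ} (hd : 2 ≤ d) : moebiusSeries d ≠ 0 := by
  have h := LSeries_one_mul_Lseries_moebius (s := (d : ℂ)) (by
    rw [Complex.natCast_re]; exact_mod_cast hd)
  have h2 : LSeries (fun n => (ArithmeticFunction.moebius n : ℂ)) (d : ℂ) = moebiusSeries d := by
    refine tsum_congr fun n => ?_
    rcases eq_or_ne n 0 with rfl | hn
    · simp
    · rw [LSeries.term_of_ne_zero hn, Complex.cpow_natCast]
  rw [h2] at h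
  exact right_ne_zero_of_mul_eq_one h

/-- Möbius inversion for sums over `N / nᵈ`. -/
lemma moebius_inversion_div_pow {d : ℕ} (hd : d ≠ 0) {P A : ℕ → ℂ} (hP : P 0 = 0)
    (hA : ∀ N, A N = ∑ n ∈ Finset.Icc 1 N, P (N / n ^ d)) (N : ℕ) :
    P N = ∑ n ∈ Finset.Icc 1 N, (ArithmeticFunction.moebius n : ℂ) * A (N / n ^ d) := by
  have hext : ∀ n ∈ Finset.Icc 1 N, A (N / n ^ d) =
      ∑ m ∈ Finset.Icc 1 N, P (N / (n * m) ^ d) := by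
    intro n hn
    rw [hA]
    simp_rw [mul_pow, ← Nat.div_div_eq_div_mul]
    -- All sums can be taken over the common range `1..N`, since the extra terms are `P 0 = 0`.
    refine Finset.sum_subset (Finset.Icc_subset_Icc_right (Nat.div_le_self _ _)) fun m hm hm' => ?_
    rw [Finset.mem_Icc] at hm hm'
    rw [Nat.div_eq_of_lt, hP]
    have : m ≤ m ^ d := Nat.le_self_pow hd m
    omega
  rw [Finset.sum_congr rfl fun n hn => by rw [hext n hn, Finset.mul_sum]]
  -- Group the pairs by their product `k = n * m`. Products beyond `N` contribute `P 0 = 0`.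
  have hfib : ∑ n ∈ Finset.Icc 1 N, ∑ m ∈ Finset.Icc 1 N,
      (ArithmeticFunction.moebius n : ℂ) * P (N / (n * m) ^ d) =
      ∑ k ∈ Finset.Icc 1 N, ∑ x ∈ k.divisorsAntidiagonal,
        (ArithmeticFunction.moebius x.1 : ℂ) * P (N / k ^ d) := by
    rw [← Finset.sum_product', Finset.sum_sigma']
    symm
    refine Finset.sum_of_injOn (fun x => x.2) ?_ ?_ ?_ ?_
    · rintro ⟨k, x⟩ hx ⟨k', x'⟩ hx' h
      simp only [Finset.coe_sigma, Set.mem_sigma_iff, Finset.mem_coe,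
        Nat.mem_divisorsAntidiagonal] at hx hx'
      obtain rfl : x = x' := h
      obtain rfl : k = k' := hx.2.1.symm.trans hx'.2.1
      rfl
    · rintro ⟨k, x⟩ hx
      simp only [Finset.coe_sigma, Set.mem_sigma_iff, Finset.mem_coe, Finset.mem_Icc,
        Nat.mem_divisorsAntidiagonal] at hx
      obtain ⟨⟨h1, h2⟩, h3, h4⟩ := hx
      simp only [Finset.coe_product, Set.mem_prod, Finset.mem_coe, Finset.mem_Icc]
      have ha : x.1 ≠ 0 := by rintro h; simp [h] at h3; omega
      have hb : x.2 ≠ 0 := by rintro h; simp [h] at h3; omega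
      have h5 : x.1 ≤ k := h3 ▸ Nat.le_mul_of_pos_right _ (Nat.pos_of_ne_zero hb)
      have h6 : x.2 ≤ k := h3 ▸ Nat.le_mul_of_pos_left _ (Nat.pos_of_ne_zero ha)
      omega
    · rintro ⟨n, m⟩ hnm h
      simp only [Finset.mem_product, Finset.mem_Icc] at hnm
      have hlt : N < n * m := by
        by_contra! hle
        refine h ⟨⟨n * m, (n, m)⟩, ?_, rfl⟩
        simp only [Finset.coe_sigma, Set.mem_sigma_iff, Finset.mem_coe, Finset.mem_Icc,
          Nat.mem_divisorsAntidiagonal]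
        have : 0 < n * m := Nat.mul_pos hnm.1.1 hnm.2.1
        exact ⟨⟨this, hle⟩, trivial, this.ne'⟩
      rw [Nat.div_eq_of_lt (hlt.trans_le (Nat.le_self_pow hd _)), hP, mul_zero]
    · rintro ⟨k, x⟩ hx
      simp only [Finset.mem_sigma, Nat.mem_divisorsAntidiagonal] at hx
      simp only [hx.2.1]
  rw [hfib]
  have hmu : ∀ k ∈ Finset.Icc 1 N, ∑ x ∈ k.divisorsAntidiagonal,
      (ArithmeticFunction.moebius x.1 : ℂ) * P (N / k ^ d) = if k = 1 then P N else 0 := by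
    intro k hk
    rw [← Finset.sum_mul, Nat.sum_divisorsAntidiagonal
      (fun n _ => (ArithmeticFunction.moebius n : ℂ))]
    have h := congrArg (fun f : ArithmeticFunction ℤ => f k) ArithmeticFunction.moebius_mul_coe_zeta
    simp only [ArithmeticFunction.coe_mul_zeta_apply, ArithmeticFunction.one_apply] at h
    have h2 : (∑ i ∈ k.divisors, (ArithmeticFunction.moebius i : ℂ)) = if k = 1 then 1 else 0 := by
      exact_mod_cast congrArg (Int.cast : ℤ → ℂ) h
    rw [h2]
    split_ifs with hk1
    · simp [hk1]
    · simp
  rw [Finset.sum_congr rfl hmu, Finset.sum_ite_eq']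
  split_ifs with h
  · rfl
  · obtain rfl : N = 0 := by simpa using h
    exact hP

lemma tendsto_natDiv_div {m : ℕ} (hm : m ≠ 0) :
    Tendsto (fun N : ℕ => ((N / m : ℕ) : ℂ) / N) atTop (𝓝 ((m : ℂ)⁻¹)) := by
  have h := (tendsto_nat_floor_mul_div_atTop (R := ℝ) (a := (m : ℝ)⁻¹) (by positivity)).comp
    tendsto_natCast_atTop_atTop
  have h2 := (Complex.continuous_ofReal.tendsto _).comp h
  simp only [Function.comp_def, Complex.ofReal_div, Complex.ofReal_natCast, Complex.ofReal_inv] at h2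
  refine h2.congr fun N => ?_
  rw [inv_mul_eq_div, Nat.floor_div_natCast, Nat.floor_natCast]

/-- If the sums `A N = ∑ P (N / nᵈ)` grow linearly, so do the `P N`. -/
lemma tendsto_div_of_sum_div_pow {d : ℕ} (hd : 2 ≤ d) {P A : ℕ → ℂ} (hP : P 0 = 0)
    (hA : ∀ N, A N = ∑ n ∈ Finset.Icc 1 N, P (N / n ^ d)) {a : ℂ}
    (ha : Tendsto (fun N : ℕ => A N / N) atTop (𝓝 a)) :
    Tendsto (fun N : ℕ => P N / N) atTop (𝓝 (a * moebiusSeries d)) := by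
  obtain ⟨B, hB⟩ : ∃ B : ℝ, ∀ N : ℕ, ‖A N / N‖ ≤ B := by
    obtain ⟨B, hB⟩ := (Metric.isBounded_range_of_tendsto _ ha).exists_norm_le
    exact ⟨B, fun N => hB _ ⟨N, rfl⟩⟩
  have hB0 : 0 ≤ B := (norm_nonneg _).trans (hB 0)
  have hA0 : A 0 = 0 := by simp [hA]
  have hAB : ∀ N : ℕ, ‖A N‖ ≤ B * N := by
    intro N
    rcases eq_or_ne N 0 with rfl | hN
    · simp [hA0]
    · have := hB N
      rwa [norm_div, div_le_iff₀ (by simpa using Nat.pos_of_ne_zero hN), Complex.norm_natCast]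
        at this
  let f : ℕ → ℕ → ℂ := fun N n => (ArithmeticFunction.moebius n : ℂ) * A (N / n ^ d) / N
  -- Writing the finite sum as a series over all `n` lets dominated convergence apply: each term
  -- tends to `μ(n) * a / n ^ d`, with majorant `B / n ^ d`, summable because `d ≥ 2`.
  have hPf : ∀ N, P N / N = ∑' n, f N n := by
    intro N
    rw [moebius_inversion_div_pow (by omega) hP hA N, Finset.sum_div,
      tsum_eq_sum (s := Finset.Icc 1 N)]
    intro n hn
    rcases eq_or_ne n 0 with rfl | hn0
    · simp [f]
    · have : N < n := by simp only [Finset.mem_Icc] at hn; omega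
      simp only [f]
      rw [Nat.div_eq_of_lt (this.trans_le (Nat.le_self_pow (by omega) _)), hA0]
      simp
  simp_rw [hPf]
  rw [moebiusSeries, ← tsum_mul_left]
  have hmu : ∀ n : ℕ, ‖(ArithmeticFunction.moebius n : ℂ)‖ ≤ 1 := by
    intro n
    rw [Complex.norm_intCast]
    exact_mod_cast ArithmeticFunction.abs_moebius_le_one
  refine tendsto_tsum_of_dominated_convergence (bound := fun n : ℕ => B * (1 / (n : ℝ) ^ d)) ?_ ?_ ?_
  · exact (Real.summable_one_div_nat_pow.2 (by omega)).mul_left B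
  · intro n
    rcases eq_or_ne n 0 with rfl | hn0
    · simp [f]
    have h1 := tendsto_natDiv_div (m := n ^ d) (pow_ne_zero _ hn0)
    have h2 : Tendsto (fun N : ℕ => N / n ^ d) atTop atTop :=
      Nat.tendsto_div_const_atTop (pow_ne_zero _ hn0)
    have h3 := (((ha.comp h2).mul h1).const_mul (ArithmeticFunction.moebius n : ℂ))
    convert h3.congr fun N => ?_ using 2
    · push_cast
      ring
    · simp only [f, Function.comp]
      rcases eq_or_ne (N / n ^ d) 0 with h0 | h0
      · simp [h0, hA0]
      · have : ((N / n ^ d : ℕ) : ℂ) ≠ 0 := by exact_mod_cast h0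
        field_simp
  · refine Eventually.of_forall fun N n => ?_
    simp only [f]
    rw [norm_div, norm_mul, Complex.norm_natCast]
    rcases eq_or_ne N 0 with rfl | hN
    · simp only [Nat.cast_zero, div_zero]
      positivity
    rw [div_le_iff₀ (by positivity)]
    calc _ ≤ 1 * (B * ((N / n ^ d : ℕ) : ℝ)) := by
          gcongr
          · exact hmu n
          · exact hAB _
      _ ≤ 1 * (B * ((N : ℝ) / (n : ℝ) ^ d)) := by
          gcongr
          exact_mod_cast Nat.cast_div_le (α := ℝ) (m := N) (n := n ^ d)
      _ = _ := by ring

end CyclicNormOne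

/-! ### Hilbert 90 and visible points. -/

namespace CyclicNormOne

variable {K : Type*} [Field K] [NumberField K]

/-- Hilbert's Theorem 90 for an automorphism `σ` generating the Galois group. -/
lemma exists_div_eq_of_norm_eq_one [IsGalois ℚ K] {σ : K ≃ₐ[ℚ] K}
    (hσ : ∀ τ : K ≃ₐ[ℚ] K, τ ∈ Subgroup.zpowers σ) {β : K} (hβ : Algebra.norm ℚ β = 1) :
    ∃ y : K, y ≠ 0 ∧ y / σ y = β := by
  classical
  let n := orderOf σ
  have hn : 0 < n := orderOf_pos σ
  -- Partial norms `β σ(β) ⋯ σ^(i-1)(β)`. The Lagrange resolvent `∑ b i * σ^i(z)` is the desired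
  -- element: applying `σ` and multiplying by `β` shifts the index by one, and `b n = N(β) = 1`
  -- closes the cycle.
  let b : ℕ → K := fun i => ∏ j ∈ Finset.range i, (σ ^ j) β
  have hbs : ∀ i, b (i + 1) = β * σ (b i) := by
    intro i
    simp only [b, map_prod]
    rw [Finset.prod_range_succ', mul_comm]
    congr 1
    refine Finset.prod_congr rfl fun j _ => ?_
    rw [pow_succ', AlgEquiv.mul_apply]
  have hbn : b n = 1 := by
    have h := Algebra.norm_eq_prod_automorphisms ℚ β
    rw [hβ, map_one] at h
    rw [h]
    refine Finset.prod_bij (fun j _ => σ ^ j) (fun _ _ => Finset.mem_univ _) ?_ ?_ (fun _ _ => rfl)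
    · intro i hi j hj hij
      exact pow_injOn_Iio_orderOf (by simpa using hi) (by simpa using hj) hij
    · intro τ _
      obtain ⟨j, hj, rfl⟩ := (isOfFinOrder_of_finite σ).mem_zpowers_iff_mem_range_orderOf.1 (hσ τ) |>
        Finset.mem_image.1
      exact ⟨j, hj, rfl⟩
  have hli : LinearIndependent K (fun i : Fin n => ((σ ^ (i : ℕ) : K ≃ₐ[ℚ] K) : K → K)) := by
    refine (linearIndependent_monoidHom K K).comp
      (fun i : Fin n => ((σ ^ (i : ℕ) : K ≃ₐ[ℚ] K) : K →* K)) fun i j hij => ?_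
    have : σ ^ (i : ℕ) = σ ^ (j : ℕ) := AlgEquiv.ext fun x => DFunLike.congr_fun hij x
    exact Fin.ext (pow_injOn_Iio_orderOf i.2 j.2 this)
  -- Independence of characters yields a non-vanishing resolvent, as the coefficient `b 0` is `1`.
  obtain ⟨z, hz⟩ : ∃ z : K, ∑ i : Fin n, b i * (σ ^ (i : ℕ)) z ≠ 0 := by
    by_contra! h
    have h2 := Fintype.linearIndependent_iff.1 hli (fun i => b i)
      (by ext z; simpa [Finset.sum_apply] using h z) ⟨0, hn⟩
    simp [b] at h2
  rw [Fin.sum_univ_eq_sum_range (fun i => b i * (σ ^ i) z)] at hz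
  refine ⟨_, hz, ?_⟩
  rw [div_eq_iff ((map_ne_zero σ).2 hz), map_sum, Finset.mul_sum]
  have h1 : ∀ i ∈ Finset.range n, β * σ (b i * (σ ^ i) z) = b (i + 1) * (σ ^ (i + 1)) z := by
    intro i _
    rw [map_mul, hbs, pow_succ', AlgEquiv.mul_apply, mul_assoc]
  rw [Finset.sum_congr rfl h1]
  have h2 := Finset.sum_range_succ (fun i => b i * (σ ^ i) z) n
  rw [Finset.sum_range_succ'] at h2
  have h3 : b n * (σ ^ n) z = b 0 * (σ ^ 0) z := by
    rw [hbn, pow_orderOf_eq_one]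
    simp [b]
  rw [h3] at h2
  exact (add_right_cancel h2).symm

lemma integralSolutions_nonempty [IsGalois ℚ K] {σ : K ≃ₐ[ℚ] K}
    (hσ : ∀ τ : K ≃ₐ[ℚ] K, τ ∈ Subgroup.zpowers σ) (β : normOne K) :
    (integralSolutions σ β).Nonempty := by
  obtain ⟨y, hy0, hy⟩ := exists_div_eq_of_norm_eq_one hσ ((mem_normOne _).1 β.2)
  obtain ⟨m, hm, hint⟩ := ((IsFractionRing.isAlgebraic_iff ℤ ℚ K).2
    (Algebra.IsAlgebraic.isAlgebraic (R := ℚ) y)).exists_integral_multiple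
  have hm' : (m : K) ≠ 0 := by exact_mod_cast hm
  have hint' : IsIntegral ℤ ((m : K) * y) := by simpa [Algebra.smul_def] using hint
  refine ⟨⟨(m : K) * y, hint'⟩, fun h => ?_, ?_⟩
  · exact mul_ne_zero hm' hy0 (congrArg (algebraMap (𝓞 K) K) h)
  · change ((m : K) * y) / σ ((m : K) * y) = _
    rw [map_mul, map_intCast, mul_div_mul_left _ _ hm', hy]

lemma exists_isVisiblePoint [IsGalois ℚ K] {σ : K ≃ₐ[ℚ] K}
    (hσ : ∀ τ : K ≃ₐ[ℚ] K, τ ∈ Subgroup.zpowers σ) (β : normOne K) :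
    ∃ α : 𝓞 K, IsVisiblePoint σ β α := by
  obtain ⟨α, hα, hmin⟩ := (measure (fun α : 𝓞 K => (Algebra.norm ℤ α).natAbs)).wf.has_min _
    (integralSolutions_nonempty hσ β)
  exact ⟨α, hα, fun γ hγ => not_lt.1 (hmin γ hγ)⟩

/-- The norm-one element `α / σ(α)` attached to a non-zero integer. -/
noncomputable def piInt (σ : K ≃ₐ[ℚ] K) {α : 𝓞 K} (h : α ≠ 0) : normOne K :=
  piMap σ (Units.mk0 (α : K) (by simpa using h))

lemma coe_piInt (σ : K ≃ₐ[ℚ] K) {α : 𝓞 K} (h : α ≠ 0) :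
    ((piInt σ h : Kˣ) : K) = (α : K) / σ (α : K) := by
  simp [piInt, piMap]

lemma piInt_eq_iff (σ : K ≃ₐ[ℚ] K) {α : 𝓞 K} (h : α ≠ 0) {β : normOne K} :
    piInt σ h = β ↔ α ∈ integralSolutions σ β := by
  rw [Subtype.ext_iff, Units.ext_iff, coe_piInt]
  exact ⟨fun h' => ⟨h, h'⟩, fun h' => h'.2⟩

lemma exists_ratCast_eq_of_map_eq [IsGalois ℚ K] {σ : K ≃ₐ[ℚ] K}
    (hσ : ∀ τ : K ≃ₐ[ℚ] K, τ ∈ Subgroup.zpowers σ) {x : K} (hx : σ x = x) :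
    ∃ q : ℚ, (q : K) = x := by
  have : x ∈ (⊥ : IntermediateField ℚ K) := by
    rw [IsGalois.mem_bot_iff_fixed]
    intro τ
    obtain ⟨k, rfl⟩ := Subgroup.mem_zpowers_iff.1 (hσ τ)
    have h1 : σ ∈ MulAction.stabilizer (K ≃ₐ[ℚ] K) x := hx
    exact zpow_mem h1 k
  obtain ⟨q, hq⟩ := IntermediateField.mem_bot.1 this
  exact ⟨q, by simpa using hq⟩

/-- Every solution is a rational integer multiple of a visible point. -/
lemma IsVisiblePoint.exists_eq_intCast_mul [IsGalois ℚ K] {σ : K ≃ₐ[ℚ] K}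
    (hσ : ∀ τ : K ≃ₐ[ℚ] K, τ ∈ Subgroup.zpowers σ) {β : normOne K} {α γ : 𝓞 K}
    (hα : IsVisiblePoint σ β α) (hγ : γ ∈ integralSolutions σ β) :
    ∃ m : ℤ, m ≠ 0 ∧ γ = m * α := by
  have hα0 : (α : K) ≠ 0 := by simpa using hα.1.1
  have hγ0 : (γ : K) ≠ 0 := by simpa using hγ.1
  have hσα : σ (α : K) ≠ 0 := by simpa using hα0
  have hσγ : σ (γ : K) ≠ 0 := by simpa using hγ0
  obtain ⟨q, hq⟩ := exists_ratCast_eq_of_map_eq hσ (x := (γ : K) / α) (by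
    have h := hα.1.2.trans hγ.2.symm
    rw [div_eq_div_iff hσα hσγ] at h
    rw [map_div₀, div_eq_div_iff hσα hα0, mul_comm, h, mul_comm])
  have hqα : (γ : K) * q.den = q.num * α := by
    rw [eq_div_iff hα0] at hq
    have h : (q : K) * q.den = q.num := by exact_mod_cast congrArg (Rat.cast : ℚ → K) q.mul_den_eq_num
    rw [← hq, ← h]
    ring
  -- Bézout for the numerator and denominator of `q = γ / α`: the integral combination `x * γ + y *
  -- α` equals `α / q.den`, so it is again a solution. Minimality of the norm of `α` then forces
  -- `q.den = 1`.
  obtain ⟨x, y, hxy⟩ := (Rat.isCoprime_num_den q : IsCoprime q.num (q.den : ℤ))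
  have hxy' : (x : K) * q.num + y * q.den = 1 := by exact_mod_cast congrArg (Int.cast : ℤ → K) hxy
  have hden : (q.den : K) ≠ 0 := by exact_mod_cast q.den_ne_zero
  let δ : 𝓞 K := x * γ + y * α
  have hδ : (δ : K) * q.den = α := by
    simp only [δ, map_add, map_mul, map_intCast]
    linear_combination (x : K) * hqα + (α : K) * hxy'
  have hδ' : δ * (q.den : 𝓞 K) = α := by
    refine RingOfIntegers.ext ?_
    simpa using hδ
  have hδ0 : δ ≠ 0 := by
    rintro h
    rw [h, zero_mul] at hδ'
    exact hα.1.1 hδ'.symm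
  have hδs : δ ∈ integralSolutions σ β := by
    refine ⟨hδ0, ?_⟩
    rw [← hα.1.2, ← hδ, map_mul, map_natCast, mul_div_mul_right _ _ hden]
  have hN := hα.2 δ hδs
  rw [← hδ', map_mul, Int.natAbs_mul] at hN
  have hNδ : 0 < (Algebra.norm ℤ δ).natAbs := by
    rw [Int.natAbs_pos]
    exact Algebra.norm_ne_zero_iff.2 hδ0
  have hNd : (Algebra.norm ℤ (q.den : 𝓞 K)).natAbs ≤ 1 := by
    by_contra! h
    nlinarith
  have hd1 : q.den = 1 := by
    have h1 : Algebra.norm ℤ (q.den : 𝓞 K) = (q.den : ℤ) ^ Module.finrank ℤ (𝓞 K) := by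
      simpa using Algebra.norm_algebraMap (S := 𝓞 K) (q.den : ℤ)
    rw [h1, Int.natAbs_pow, Int.natAbs_natCast] at hNd
    have h2 : Module.finrank ℤ (𝓞 K) ≠ 0 := by
      rw [RingOfIntegers.rank]
      exact Module.finrank_pos.ne'
    have := Nat.le_self_pow h2 q.den
    have := q.den_pos
    omega
  refine ⟨q.num, ?_, ?_⟩
  · rintro h
    rw [h, hd1] at hqα
    simp at hqα
    exact hγ.1 hqα
  · refine RingOfIntegers.ext ?_
    rw [hd1] at hqα
    simpa using hqα

end CyclicNormOne

/-! ### Principal ideals as classes with a multiplicity. -/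

namespace CyclicNormOne

open scoped nonZeroDivisors

variable {K : Type*} [Field K] [NumberField K]

/-- The class modulo `π(U)` of the norm-one element `α / σ(α)`. -/
noncomputable def intClass (σ : K ≃ₐ[ℚ] K) {α : 𝓞 K} (h : α ≠ 0) : NormOneClass σ :=
  QuotientGroup.mk (piInt σ h)

lemma intClass_eq_of_associated (σ : K ≃ₐ[ℚ] K) {α γ : 𝓞 K} (hα : α ≠ 0) (hγ : γ ≠ 0)
    (h : Associated α γ) : intClass σ hα = intClass σ hγ := by
  obtain ⟨u, rfl⟩ := h
  refine QuotientGroup.eq.2 ⟨Units.map (algebraMap (𝓞 K) K : 𝓞 K →* K) u, ⟨u, rfl⟩, ?_⟩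
  rw [eq_inv_mul_iff_mul_eq, piInt, piInt, ← map_mul]
  congr 1
  ext
  simp

lemma intClass_natCast_mul (σ : K ≃ₐ[ℚ] K) {α : 𝓞 K} {n : ℕ} (hn : (n : 𝓞 K) * α ≠ 0) :
    intClass σ hn = intClass σ (right_ne_zero_of_mul hn) := by
  refine congrArg QuotientGroup.mk ?_
  rw [piInt_eq_iff]
  refine ⟨hn, ?_⟩
  have : (n : K) ≠ 0 := by
    have := left_ne_zero_of_mul hn
    exact_mod_cast this
  rw [coe_piInt]
  simp [mul_div_mul_left _ _ this]

variable [IsGalois ℚ K] {σ : K ≃ₐ[ℚ] K}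

/-- A visible point for a representative of a class. -/
noncomputable def visiblePoint (hσ : ∀ τ : K ≃ₐ[ℚ] K, τ ∈ Subgroup.zpowers σ)
    (c : NormOneClass σ) : 𝓞 K :=
  (exists_isVisiblePoint hσ c.out).choose

variable (hσ : ∀ τ : K ≃ₐ[ℚ] K, τ ∈ Subgroup.zpowers σ)

lemma isVisiblePoint_visiblePoint (c : NormOneClass σ) :
    IsVisiblePoint σ c.out (visiblePoint hσ c) :=
  (exists_isVisiblePoint hσ c.out).choose_spec

lemma visiblePoint_ne_zero (c : NormOneClass σ) : visiblePoint hσ c ≠ 0 :=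
  (isVisiblePoint_visiblePoint hσ c).1.1

lemma classHeight_eq (c : NormOneClass σ) :
    classHeight σ c = (Algebra.norm ℤ (visiblePoint hσ c)).natAbs := by
  rw [← height_eq (isVisiblePoint_visiblePoint hσ c)]
  conv_lhs => rw [← Quotient.out_eq' c]
  rfl

include hσ in
lemma classHeight_pos (c : NormOneClass σ) : 0 < classHeight σ c := by
  rw [classHeight_eq hσ, Int.natAbs_pos]
  exact Algebra.norm_ne_zero_iff.2 (visiblePoint_ne_zero hσ c)

lemma intClass_visiblePoint (c : NormOneClass σ) :
    intClass σ (visiblePoint_ne_zero hσ c) = c := by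
  rw [intClass, (piInt_eq_iff σ _).2 (isVisiblePoint_visiblePoint hσ c).1]
  exact Quotient.out_eq' c

lemma natCast_mul_visiblePoint_ne_zero (p : NormOneClass σ × ℕ+) :
    ((p.2 : ℕ) : 𝓞 K) * visiblePoint hσ p.1 ≠ 0 :=
  mul_ne_zero (by exact_mod_cast p.2.ne_zero) (visiblePoint_ne_zero hσ p.1)

lemma natAbs_norm_natCast_mul_visiblePoint (p : NormOneClass σ × ℕ+) :
    (Algebra.norm ℤ (((p.2 : ℕ) : 𝓞 K) * visiblePoint hσ p.1)).natAbs =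
      classHeight σ p.1 * (p.2 : ℕ) ^ Module.finrank ℚ K := by
  have h1 : Algebra.norm ℤ ((p.2 : ℕ) : 𝓞 K) = ((p.2 : ℕ) : ℤ) ^ Module.finrank ℤ (𝓞 K) := by
    simpa using Algebra.norm_algebraMap (S := 𝓞 K) ((p.2 : ℕ) : ℤ)
  rw [map_mul, Int.natAbs_mul, h1, classHeight_eq hσ, Int.natAbs_pow, Int.natAbs_natCast,
    RingOfIntegers.rank, mul_comm]

/-- The principal ideal generated by a multiple of a visible point. -/
noncomputable def multipleIdeal (p : NormOneClass σ × ℕ+) :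
    {I : (Ideal (𝓞 K))⁰ // Submodule.IsPrincipal (I : Ideal (𝓞 K))} :=
  ⟨⟨Ideal.span {((p.2 : ℕ) : 𝓞 K) * visiblePoint hσ p.1}, mem_nonZeroDivisors_of_ne_zero (by
    simpa using natCast_mul_visiblePoint_ne_zero hσ p)⟩, ⟨⟨_, rfl⟩⟩⟩

/-- A generator determines its class, since units and positive integers do not change it. The norm
`h * n ^ d` then determines `n`. -/
lemma multipleIdeal_injective : Function.Injective (multipleIdeal hσ) := by
  intro p q h
  have h1 : Associated (((p.2 : ℕ) : 𝓞 K) * visiblePoint hσ p.1)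
      (((q.2 : ℕ) : 𝓞 K) * visiblePoint hσ q.1) :=
    Ideal.span_singleton_eq_span_singleton.1 (congrArg (fun I => (I.1 : Ideal (𝓞 K))) h)
  have h2 : p.1 = q.1 := by
    have := intClass_eq_of_associated σ (natCast_mul_visiblePoint_ne_zero hσ p)
      (natCast_mul_visiblePoint_ne_zero hσ q) h1
    rwa [intClass_natCast_mul, intClass_natCast_mul, intClass_visiblePoint,
      intClass_visiblePoint] at this
  have h3 := Int.natAbs_eq_iff_associated.2 (h1.map (Algebra.norm ℤ))
  rw [natAbs_norm_natCast_mul_visiblePoint, natAbs_norm_natCast_mul_visiblePoint, h2,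
    Nat.mul_right_inj (classHeight_pos hσ _).ne'] at h3
  exact Prod.ext h2 (PNat.coe_injective (Nat.pow_left_injective Module.finrank_pos.ne' h3))

lemma multipleIdeal_surjective : Function.Surjective (multipleIdeal hσ) := by
  rintro ⟨⟨I, hI0⟩, ⟨⟨γ, hγ⟩⟩⟩
  change I = Ideal.span {γ} at hγ
  have hγ0 : γ ≠ 0 := by
    rintro rfl
    refine nonZeroDivisors.ne_zero hI0 ?_
    simpa using hγ
  let c := intClass σ hγ0
  -- The visible point solves the equation for the chosen representative `c.out`, so the generator
  -- is first corrected by a unit to solve the same equation.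
  obtain ⟨w, ⟨_, ⟨u, rfl⟩, hu⟩, hw⟩ : ∃ w ∈ piUnits σ, piInt σ hγ0 * w = c.out := by
    refine ⟨(piInt σ hγ0)⁻¹ * c.out, QuotientGroup.eq.1 ?_, by group⟩
    exact (Quotient.out_eq' c).symm
  have hsol : γ * u ∈ integralSolutions σ c.out := by
    refine ⟨mul_ne_zero hγ0 u.ne_zero, ?_⟩
    rw [← hw, ← hu]
    simp [piMap, coe_piInt, mul_div_mul_comm]
  obtain ⟨m, hm0, hm⟩ := (isVisiblePoint_visiblePoint hσ c).exists_eq_intCast_mul hσ hsol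
  refine ⟨(c, ⟨m.natAbs, Int.natAbs_pos.2 hm0⟩), Subtype.ext (Subtype.ext ?_)⟩
  change Ideal.span _ = I
  rw [hγ, Ideal.span_singleton_eq_span_singleton]
  have h1 : Associated (γ * u) γ := associated_mul_unit_left _ _ u.isUnit
  refine Associated.trans ?_ h1
  rw [hm]
  refine Associated.mul_right ?_ _
  -- The sign of `m` is a unit, so passing to `m.natAbs` keeps the ideal.
  have h2 := (Int.associated_natAbs m).symm.map (Int.castRingHom (𝓞 K))
  simpa using h2

/-- Non-zero principal ideals correspond to pairs of a class and a positive rational integer. -/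
noncomputable def multipleIdealEquiv : NormOneClass σ × ℕ+ ≃
    {I : (Ideal (𝓞 K))⁰ // Submodule.IsPrincipal (I : Ideal (𝓞 K))} :=
  Equiv.ofBijective _ ⟨multipleIdeal_injective hσ, multipleIdeal_surjective hσ⟩

lemma absNorm_multipleIdealEquiv (p : NormOneClass σ × ℕ+) :
    Ideal.absNorm ((multipleIdealEquiv hσ p).1 : Ideal (𝓞 K)) =
      classHeight σ p.1 * (p.2 : ℕ) ^ Module.finrank ℚ K := by
  rw [← natAbs_norm_natCast_mul_visiblePoint hσ]
  exact Ideal.absNorm_span_singleton _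

open mixedEmbedding fundamentalCone Units

/-- Integers in the fundamental cone correspond to a class, a positive rational integer and a root
of unity. -/
noncomputable def integerSetEquivClass :
    integerSet K ≃ (NormOneClass σ × ℕ+) × torsion K :=
  (integerSetEquiv K).trans ((multipleIdealEquiv hσ).symm.prodCongr (Equiv.refl _))

/-- The correspondence passes through ideals, so generators agree only up to a unit. That suffices
to compare their norms and classes. -/
lemma span_preimageOfMemIntegerSet (a : integerSet K) :
    Ideal.span {(preimageOfMemIntegerSet a : 𝓞 K)} =
      Ideal.span {(((integerSetEquivClass hσ a).1.2 : ℕ) : 𝓞 K) *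
        visiblePoint hσ (integerSetEquivClass hσ a).1.1} := by
  rw [← integerSetEquiv_apply_fst]
  have h : multipleIdealEquiv hσ (integerSetEquivClass hσ a).1 = (integerSetEquiv K a).1 := by
    simp [integerSetEquivClass]
  rw [← h]
  rfl

lemma intNorm_eq (a : integerSet K) :
    intNorm a = classHeight σ (integerSetEquivClass hσ a).1.1 *
      ((integerSetEquivClass hσ a).1.2 : ℕ) ^ Module.finrank ℚ K := by
  rw [← natAbs_norm_natCast_mul_visiblePoint hσ, intNorm, ← Ideal.absNorm_span_singleton,
    span_preimageOfMemIntegerSet hσ, Ideal.absNorm_span_singleton]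

lemma intClass_preimageOfMemIntegerSet (a : integerSet K) :
    intClass σ (nonZeroDivisors.coe_ne_zero (preimageOfMemIntegerSet a)) =
      (integerSetEquivClass hσ a).1.1 := by
  rw [intClass_eq_of_associated σ _
    (natCast_mul_visiblePoint_ne_zero hσ (integerSetEquivClass hσ a).1)
    (Ideal.span_singleton_eq_span_singleton.1 (span_preimageOfMemIntegerSet hσ a)),
    intClass_natCast_mul, intClass_visiblePoint]

include hσ in
lemma finite_setOf_classHeight_le (N : ℕ) : {c : NormOneClass σ | classHeight σ c ≤ N}.Finite := by
  have h := Ideal.finite_setOfPred_absNorm_le₀ (S := 𝓞 K) N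
  -- Multiplicity `1` embeds the classes of bounded height into the ideals of bounded norm, which
  -- are finite in number.
  refine Set.Finite.of_injOn (f := fun c => (multipleIdeal hσ (c, 1)).1) (t := _) ?_ ?_ h
  · intro c hc
    have h1 := absNorm_multipleIdealEquiv hσ (c, 1)
    simp only [PNat.one_coe, one_pow, mul_one] at h1
    exact (le_of_eq h1).trans hc
  · intro c _ c' _ hcc
    exact congrArg Prod.fst (multipleIdeal_injective hσ (Subtype.ext hcc))

end CyclicNormOne

/-! ### Characters of the torus as functions on the mixed space. -/

namespace CyclicNormOne

open mixedEmbedding InfinitePlace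

variable {K : Type*} [Field K] [NumberField K]

lemma mult_smul (τ : K ≃ₐ[ℚ] K) (w : InfinitePlace K) : (τ • w).mult = w.mult := by
  by_cases h : IsReal w
  · rw [h.mult_eq_one, (isReal_smul_iff.2 h).mult_eq_one]
  · rw [not_isReal_iff_isComplex] at h
    rw [h.mult_eq_two, (isComplex_smul_iff.2 h).mult_eq_two]

/-- The linear map `x ↦ x - x ∘ σ⁻¹` on vectors indexed by the places, with values in `ker Σ`. -/
noncomputable def placeDiff (σ : K ≃ₐ[ℚ] K) : (InfinitePlace K → ℝ) →ₗ[ℝ] kerSum K :=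
  LinearMap.codRestrict (kerSum K)
    (LinearMap.id - LinearMap.funLeft ℝ ℝ (fun w : InfinitePlace K => σ⁻¹ • w)) fun x => by
      rw [mem_kerSum]
      simp only [LinearMap.sub_apply, LinearMap.id_coe, id_eq, Pi.sub_apply,
        LinearMap.funLeft_apply, Finset.sum_sub_distrib]
      rw [sub_eq_zero]
      exact (Equiv.sum_comp (MulAction.toPerm σ⁻¹) x).symm

lemma placeDiff_apply (σ : K ≃ₐ[ℚ] K) (x : InfinitePlace K → ℝ) (w : InfinitePlace K) :
    (placeDiff σ x : InfinitePlace K → ℝ) w = x w - x (σ⁻¹ • w) := rfl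

/-- Multiplicities are constant on Galois orbits. This makes `mixedChar` invariant under real
scaling. -/
lemma placeDiff_mult (σ : K ≃ₐ[ℚ] K) (c : ℝ) :
    placeDiff σ (fun w => w.mult * c) = 0 := by
  ext w
  rw [placeDiff_apply, mult_smul, sub_self]
  rfl

/-- A vector in the kernel is invariant under the whole Galois group, which permutes the places
transitively. It is therefore constant, and zero because its coordinates sum to zero. Injectivity
gives surjectivity in finite dimension. -/
lemma exists_kerSum_placeDiff_eq [IsGalois ℚ K] {σ : K ≃ₐ[ℚ] K}
    (hσ : ∀ τ : K ≃ₐ[ℚ] K, τ ∈ Subgroup.zpowers σ) (y : kerSum K) :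
    ∃ x : kerSum K, placeDiff σ x = y := by
  let f : kerSum K →ₗ[ℝ] kerSum K := placeDiff σ ∘ₗ (kerSum K).subtype
  have hinj : Function.Injective f := by
    rw [injective_iff_map_eq_zero]
    intro x hx
    have h1 : ∀ w, x.1 (σ⁻¹ • w) = x.1 w := by
      intro w
      have := congrFun (congrArg Subtype.val hx) w
      change x.1 w - x.1 (σ⁻¹ • w) = 0 at this
      linarith
    have h2 : ∀ (τ : K ≃ₐ[ℚ] K) (w), x.1 (τ • w) = x.1 w := by
      let S : Subgroup (K ≃ₐ[ℚ] K) :=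
        { carrier := {τ | ∀ w, x.1 (τ • w) = x.1 w}
          one_mem' := fun w => by rw [one_smul]
          mul_mem' := fun {a b} ha hb w => by rw [mul_smul, ha, hb]
          inv_mem' := fun {a} ha w => by rw [← ha (a⁻¹ • w), smul_inv_smul] }
      have hS : σ ∈ S := by
        rw [← inv_mem_iff]
        exact h1
      intro τ
      exact (Subgroup.zpowers_le.2 hS) (hσ τ)
    have h3 : ∀ w w', x.1 w = x.1 w' := by
      intro w w'
      obtain ⟨τ, rfl⟩ := exists_smul_eq_of_comap_eq (k := ℚ) (w := w) (w' := w')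
        (Subsingleton.elim _ _)
      exact (h2 τ w).symm
    ext w
    have h4 := (mem_kerSum _).1 x.2
    rw [Finset.sum_congr rfl fun w' _ => h3 w' w, Finset.sum_const, nsmul_eq_mul] at h4
    have : ((Finset.univ : Finset (InfinitePlace K)).card : ℝ) ≠ 0 := by
      exact_mod_cast Finset.card_ne_zero_of_mem (Finset.mem_univ w)
    simpa using (mul_eq_zero.1 h4).resolve_left this
  obtain ⟨x, hx⟩ := LinearMap.injective_iff_surjective.1 hinj y
  exact ⟨x, hx⟩

/-- The extension of the regulator map to the mixed space. -/
noncomputable def mixedLog (y : mixedSpace K) : InfinitePlace K → ℝ :=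
  fun w => w.mult * Real.log (normAtPlace w y)

lemma mixedLog_mul {y z : mixedSpace K} (hy : mixedEmbedding.norm y ≠ 0)
    (hz : mixedEmbedding.norm z ≠ 0) : mixedLog (y * z) = mixedLog y + mixedLog z := by
  ext w
  simp only [mixedLog, Pi.add_apply, map_mul]
  rw [Real.log_mul (mixedEmbedding.norm_ne_zero_iff.1 hy w)
    (mixedEmbedding.norm_ne_zero_iff.1 hz w), mul_add]

lemma mixedLog_smul {y : mixedSpace K} (hy : mixedEmbedding.norm y ≠ 0) {c : ℝ} (hc : c ≠ 0) :
    mixedLog (c • y) = (fun w => w.mult * Real.log |c|) + mixedLog y := by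
  ext w
  simp only [mixedLog, Pi.add_apply, normAtPlace_smul]
  rw [Real.log_mul (abs_ne_zero.2 hc) (mixedEmbedding.norm_ne_zero_iff.1 hy w), mul_add]

/-- The function on the mixed space induced by a character of the torus through `α ↦ α / σ(α)`. -/
noncomputable def mixedChar (σ : K ≃ₐ[ℚ] K) (χ : AddChar (Torus K) Circle) (y : mixedSpace K) : ℂ :=
  χ (Torus.mk K (placeDiff σ (mixedLog y)))

variable (σ : K ≃ₐ[ℚ] K) (χ : AddChar (Torus K) Circle)

lemma norm_mixedChar (y : mixedSpace K) : ‖mixedChar σ χ y‖ = 1 := Circle.norm_coe _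

lemma mixedChar_mul {y z : mixedSpace K} (hy : mixedEmbedding.norm y ≠ 0)
    (hz : mixedEmbedding.norm z ≠ 0) :
    mixedChar σ χ (y * z) = mixedChar σ χ y * mixedChar σ χ z := by
  rw [mixedChar, mixedLog_mul hy hz, map_add, map_add, AddChar.map_add_eq_mul, Circle.coe_mul]
  rfl

lemma mixedChar_smul {y : mixedSpace K} (hy : mixedEmbedding.norm y ≠ 0) {c : ℝ} (hc : c ≠ 0) :
    mixedChar σ χ (c • y) = mixedChar σ χ y := by
  rw [mixedChar, mixedLog_smul hy hc, map_add, placeDiff_mult, zero_add]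
  rfl

lemma mixedChar_mixedEmbedding {α : 𝓞 K} (hα : α ≠ 0) :
    mixedChar σ χ (mixedEmbedding K α) = χ (classTilde σ (intClass σ hα)) := by
  have h : classTilde σ (intClass σ hα) = tilde (piInt σ hα) := rfl
  rw [h, mixedChar, tilde]
  congr 3
  ext w
  have h1 : w (α : K) ≠ 0 := by simpa using hα
  have h2 : w (σ (α : K)) ≠ 0 := by simpa using hα
  have h3 : (σ⁻¹ • w) (α : K) = w (σ (α : K)) := rfl
  rw [placeDiff_apply]
  simp only [mixedLog, logMap, mult_smul, normAtPlace_apply, AddMonoidHom.coe_mk, ZeroHom.coe_mk,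
    toMul_ofMul, coe_piInt, map_div₀, h3, Real.log_div h1 h2, mul_sub]

lemma mixedChar_unit (u : (𝓞 K)ˣ) : mixedChar σ χ (mixedEmbedding K (u : K)) = 1 := by
  have h := mixedChar_mixedEmbedding σ χ u.ne_zero
  have h2 : classTilde σ (intClass σ u.ne_zero) = 0 := by
    refine tilde_piUnits σ ⟨_, ⟨u, rfl⟩, ?_⟩
    rw [piInt]
    congr 1
    exact Units.ext rfl
  rw [h2, AddChar.map_zero_eq_one, Circle.coe_one] at h
  exact h

variable {χ} in
lemma continuousAt_mixedChar (hχ : Continuous χ) {y : mixedSpace K}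
    (hy : mixedEmbedding.norm y ≠ 0) : ContinuousAt (mixedChar σ χ) y := by
  have h1 : ContinuousAt (mixedLog (K := K)) y := by
    refine continuousAt_pi.2 fun w => ?_
    exact continuousAt_const.mul ((continuous_normAtPlace w).continuousAt.log
      (mixedEmbedding.norm_ne_zero_iff.1 hy w))
  have h2 : Continuous (placeDiff σ) := LinearMap.continuous_of_finiteDimensional _
  have h3 : Continuous (Torus.mk K) := continuous_quot_mk (r := _)
  exact ((continuous_subtype_val.comp (hχ.comp (h3.comp h2))).continuousAt).comp h1

variable {χ} in
lemma exists_mixedChar_ne_one [IsGalois ℚ K] {σ : K ≃ₐ[ℚ] K}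
    (hσ : ∀ τ : K ≃ₐ[ℚ] K, τ ∈ Subgroup.zpowers σ) (hχ : χ ≠ 1) :
    ∃ z : mixedSpace K, mixedEmbedding.norm z = 1 ∧ mixedChar σ χ z ≠ 1 := by
  obtain ⟨t, ht⟩ : ∃ t, χ t ≠ 1 := by
    by_contra! h
    exact hχ (DFunLike.ext _ _ h)
  obtain ⟨y, rfl⟩ := QuotientAddGroup.mk'_surjective (logUnits K) t
  obtain ⟨x, rfl⟩ := exists_kerSum_placeDiff_eq hσ y
  -- Dividing by the multiplicity makes `mixedLog z = x`; the norm is then `exp (∑ x) = 1`.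
  let z : mixedSpace K := mixedSpaceOfRealSpace fun w => Real.exp (x.1 w / w.mult)
  have hz : ∀ w, normAtPlace w z = Real.exp (x.1 w / w.mult) := fun w =>
    normAtPlace_mixedSpaceOfRealSpace (Real.exp_pos _).le
  have hm : ∀ w : InfinitePlace K, (w.mult : ℝ) ≠ 0 := fun w => mult_coe_ne_zero
  have hlog : mixedLog z = x.1 := by
    ext w
    rw [mixedLog, hz, Real.log_exp, mul_div_cancel₀ _ (hm w)]
  refine ⟨z, ?_, ?_⟩
  · rw [mixedEmbedding.norm_apply]
    have : ∀ w, normAtPlace w z ^ w.mult = Real.exp (x.1 w) := by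
      intro w
      rw [hz, ← Real.exp_nat_mul, mul_div_cancel₀ _ (hm w)]
    simp_rw [this]
    rw [← Real.exp_sum, (mem_kerSum _).1 x.2, Real.exp_zero]
  · rw [mixedChar, hlog]
    exact fun h => ht (Circle.coe_eq_one.1 h)

/-- The function `min(N(y) / δ, 1) χ(y)` on the mixed space. -/
noncomputable def cutoffChar (δ : ℝ) (y : mixedSpace K) : ℂ :=
  (min (mixedEmbedding.norm y / δ) 1 : ℝ) * mixedChar σ χ y

variable {χ} in
-- `mixedChar` may be discontinuous where the norm vanishes, but it has modulus one and the weight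
-- tends to zero there.
lemma continuous_cutoffChar (hχ : Continuous χ) (δ : ℝ) :
    Continuous (cutoffChar σ χ δ) := by
  have h0 : Continuous fun y : mixedSpace K => min (mixedEmbedding.norm y / δ) 1 :=
    ((mixedEmbedding.continuous_norm K).div_const δ).min continuous_const
  refine continuous_iff_continuousAt.2 fun y => ?_
  by_cases hy : mixedEmbedding.norm y = 0
  · have h1 : cutoffChar σ χ δ y = 0 := by simp [cutoffChar, hy]
    rw [ContinuousAt, h1, tendsto_zero_iff_norm_tendsto_zero]
    have h2 := (h0.tendsto y).norm
    simp only [hy, zero_div, zero_le_one, min_eq_left, norm_zero] at h2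
    refine h2.congr fun z => ?_
    rw [cutoffChar, norm_mul, norm_mixedChar, mul_one, Complex.norm_real]
  · exact (Complex.continuous_ofReal.comp h0).continuousAt.mul (continuousAt_mixedChar σ hχ hy)

end CyclicNormOne

/-! ### The fundamental cone as a fundamental domain, and norm-one translations. -/

namespace CyclicNormOne

open mixedEmbedding InfinitePlace Units MeasureTheory

variable {K : Type*} [Field K] [NumberField K]

lemma abs_det_mulLeft (z : mixedSpace K) :
    |LinearMap.det (LinearMap.mulLeft ℝ z)| = mixedEmbedding.norm z := by
  classical
  have h : LinearMap.mulLeft ℝ z = LinearMap.prodMap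
      (LinearMap.pi fun w => (LinearMap.mulLeft ℝ (z.1 w)).comp (LinearMap.proj w))
      (LinearMap.pi fun w => (LinearMap.mulLeft ℝ (z.2 w)).comp (LinearMap.proj w)) := by
    ext <;> simp
  have hc : ∀ c : ℂ, LinearMap.det (LinearMap.mulLeft ℝ c) = ‖c‖ ^ 2 := fun c => by
    rw [← Complex.normSq_eq_norm_sq]
    exact Algebra.norm_complex_apply c
  rw [h, LinearMap.det_prodMap, LinearMap.det_pi, LinearMap.det_pi, abs_mul, Finset.abs_prod,
    Finset.abs_prod, mixedEmbedding.norm_apply, prod_eq_prod_mul_prod]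
  congr 1
  · refine Finset.prod_congr rfl fun w _ => ?_
    rw [LinearMap.det_mulLeft, normAtPlace_apply_of_isReal w.2, w.2.mult_eq_one, pow_one]
    rfl
  · refine Finset.prod_congr rfl fun w _ => ?_
    rw [hc, normAtPlace_apply_of_isComplex w.2, w.2.mult_eq_two]
    exact abs_of_nonneg (sq_nonneg _)

lemma det_mulLeft_ne_zero {z : mixedSpace K} (hz : mixedEmbedding.norm z ≠ 0) :
    LinearMap.det (LinearMap.mulLeft ℝ z) ≠ 0 := by
  rwa [← abs_ne_zero, abs_det_mulLeft]

lemma measurableEmbedding_mul_left {z : mixedSpace K} (hz : mixedEmbedding.norm z ≠ 0) :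
    MeasurableEmbedding fun y => z * y := by
  classical
  exact (LinearMap.equivOfDetNeZero _
    (det_mulLeft_ne_zero hz)).toContinuousLinearEquiv.toHomeomorph.measurableEmbedding

variable (μ : Measure (mixedSpace K)) [μ.IsAddHaarMeasure]

lemma measurePreserving_mul_left {z : mixedSpace K} (hz : mixedEmbedding.norm z = 1) :
    MeasurePreserving (fun y => z * y) μ μ := by
  classical
  have hd := abs_det_mulLeft z
  rw [hz] at hd
  have hd0 := det_mulLeft_ne_zero (z := z) (by simp [hz])
  refine ⟨measurable_const_mul z, ?_⟩
  have h := Measure.map_linearMap_addHaar_eq_smul_addHaar μ hd0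
  rw [abs_inv, hd, inv_one, ENNReal.ofReal_one, one_smul] at h
  exact h

/-- The zero locus of the norm is a finite union of proper real subspaces, one for each place. -/
lemma ae_norm_ne_zero : ∀ᵐ y ∂μ, mixedEmbedding.norm y ≠ 0 := by
  classical
  have h : ∀ w : InfinitePlace K, ∀ᵐ y ∂μ, normAtPlace w y ≠ 0 := by
    intro w
    let S : Submodule ℝ (mixedSpace K) :=
      { carrier := {y | normAtPlace w y = 0}
        zero_mem' := map_zero _
        add_mem' := fun {a b} ha hb => le_antisymm
          ((normAtPlace_add_le w a b).trans_eq (by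
            rw [Set.mem_ofPred.1 ha, Set.mem_ofPred.1 hb, add_zero])) (normAtPlace_nonneg w _)
        smul_mem' := fun c a ha => by
          rw [Set.mem_ofPred, normAtPlace_smul, Set.mem_ofPred.1 ha, mul_zero] }
    have hS : S ≠ ⊤ := by
      intro h
      have : (1 : mixedSpace K) ∈ S := h ▸ Submodule.mem_top
      have h1 : normAtPlace w (1 : mixedSpace K) = 0 := this
      simp at h1
    rw [ae_iff]
    simpa using! Measure.addHaar_submodule μ S hS
  filter_upwards [ae_all_iff.2 h] with y hy
  exact mixedEmbedding.norm_ne_zero_iff.2 hy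

/-- The free group of units generated by a fundamental system. -/
noncomputable def freeUnits (K : Type*) [Field K] [NumberField K] : Subgroup (𝓞 K)ˣ :=
  Subgroup.closure (Set.range (fundSystem K))

/-- This is the uniqueness of exponents in Dirichlet's unit theorem. -/
lemma eq_one_of_mem_freeUnits_of_mem_torsion {u : (𝓞 K)ˣ} (hu : u ∈ freeUnits K)
    (ht : u ∈ torsion K) : u = 1 := by
  obtain ⟨e, rfl⟩ : ∃ e : Fin (rank K) → ℤ, u = ∏ i, fundSystem K i ^ e i := by
    classical
    refine Subgroup.closure_induction ?_ ⟨0, by simp⟩ ?_ ?_ hu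
    · rintro _ ⟨i, rfl⟩
      exact ⟨Pi.single i 1, by simp [Pi.single_apply, Finset.prod_ite_eq']⟩
    · rintro _ _ _ _ ⟨a, rfl⟩ ⟨b, rfl⟩
      exact ⟨a + b, by simp [zpow_add, Finset.prod_mul_distrib]⟩
    · rintro _ _ ⟨a, rfl⟩
      exact ⟨-a, by simp⟩
  have h := (exist_unique_eq_mul_prod K (∏ i, fundSystem K i ^ e i)).unique
    (y₁ := (1, e)) (y₂ := (⟨_, ht⟩, 0)) (by simp) (by simp)
  simpa using congrArg (fun p => (p.1 : (𝓞 K)ˣ)) h.symm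

/-- Unit translates of the cone cover all elements of non-zero norm, and only torsion units carry a
point of the cone back into it. Since torsion stabilizes the cone, the complement `freeUnits K` is
the group that tiles. -/
lemma isFundamentalDomain_fundamentalCone :
    IsFundamentalDomain (freeUnits K) (fundamentalCone K) μ := by
  refine IsFundamentalDomain.mk'' (measurableSet_fundamentalCone K).nullMeasurableSet ?_ ?_ ?_
  · filter_upwards [ae_norm_ne_zero μ] with y hy
    obtain ⟨u, hu⟩ := fundamentalCone.exists_unit_smul_mem hy
    have : u ∈ freeUnits K ⊔ torsion K := by
      rw [freeUnits, closure_fundSystem_sup_torsion_eq_top]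
      trivial
    obtain ⟨g, hg, ζ, hζ, rfl⟩ := Subgroup.mem_sup.1 this
    refine ⟨⟨g, hg⟩, ?_⟩
    have h := fundamentalCone.torsion_smul_mem_of_mem hu (inv_mem hζ)
    rwa [smul_smul, mul_comm g, _root_.inv_mul_cancel_left] at h
  · rintro ⟨g, hg⟩ hg1
    refine Disjoint.aedisjoint (Set.disjoint_left.2 ?_)
    rintro _ ⟨y, hy, rfl⟩ hy'
    refine hg1 (Subtype.ext ?_)
    exact eq_one_of_mem_freeUnits_of_mem_torsion hg
      ((fundamentalCone.unit_smul_mem_iff_mem_torsion hy g).1 hy')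
  · rintro ⟨g, hg⟩
    exact (measurePreserving_mul_left μ (norm_unit g)).quasiMeasurePreserving

instance : SMulInvariantMeasure (freeUnits K) (mixedSpace K) μ where
  measure_preimage_smul g _ hs :=
    (measurePreserving_mul_left μ (norm_unit (g : (𝓞 K)ˣ))).measure_preimage hs.nullMeasurableSet

instance : MeasurableConstSMul (freeUnits K) (mixedSpace K) where
  measurable_const_smul g := measurable_const_mul (mixedEmbedding K ((g : (𝓞 K)ˣ) : K))

instance : Countable (freeUnits K) := by
  have : Countable (𝓞 K) := (RingOfIntegers.basis K).equivFun.toEquiv.countable_iff.2 inferInstance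
  exact Function.Injective.countable (f := fun g : freeUnits K => ((g : (𝓞 K)ˣ) : 𝓞 K))
    fun g g' h => Subtype.ext (Units.ext h)

/-- The integral of a function over the fundamental cone vanishes if the function is invariant
under units and multiplied by a constant other than `1` on translation by an element of norm `1`. -/
lemma setIntegral_fundamentalCone_eq_zero {f : mixedSpace K → ℂ}
    (hf : ∀ (u : (𝓞 K)ˣ) y, f (u • y) = f y) {z : mixedSpace K} (hz : mixedEmbedding.norm z = 1)
    {c : ℂ} (hc : c ≠ 1) (hfz : ∀ y, f (z * y) = c * f y) :
    ∫ y in fundamentalCone K, f y ∂μ = 0 := by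
  have hD := isFundamentalDomain_fundamentalCone μ
  have hmp := measurePreserving_mul_left μ hz
  have hD' : IsFundamentalDomain (freeUnits K) ((fun y => z * y) ⁻¹' fundamentalCone K) μ :=
    hD.preimage_of_equiv hmp.quasiMeasurePreserving (e := id) Function.bijective_id fun g y =>
      mul_left_comm _ _ _
  -- Integrate `f (z * y)` over both domains: a change of variables on the translated cone gives `∫
  -- f`, while on the cone itself the integral is `c * ∫ f`.
  have h1 := hD'.setIntegral_eq hD (f := fun y => f (z * y)) fun g y => by
    rw [hfz, hfz]
    exact congrArg (c * ·) (hf g y)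
  rw [hmp.setIntegral_preimage_emb (measurableEmbedding_mul_left (by simp [hz])) f] at h1
  simp_rw [hfz, integral_const_mul] at h1
  have h2 : (c - 1) * ∫ y in fundamentalCone K, f y ∂μ = 0 := by linear_combination -h1
  exact (mul_eq_zero.1 h2).resolve_left (sub_ne_zero.2 hc)

end CyclicNormOne

/-! ### Lattice-point sums as Riemann sums. -/

namespace CyclicNormOne

open mixedEmbedding InfinitePlace Units MeasureTheory fundamentalCone
open scoped nonZeroDivisors Pointwise

variable {K : Type*} [Field K] [NumberField K]

lemma setIntegral_cutoffChar_eq_zero [IsGalois ℚ K] {σ : K ≃ₐ[ℚ] K}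
    (hσ : ∀ τ : K ≃ₐ[ℚ] K, τ ∈ Subgroup.zpowers σ) {χ : AddChar (Torus K) Circle} (hχ : χ ≠ 1)
    (δ : ℝ) (μ : Measure (mixedSpace K)) [μ.IsAddHaarMeasure] :
    ∫ y in normLeOne K, cutoffChar σ χ δ y ∂μ = 0 := by
  obtain ⟨z, hz, hc⟩ := exists_mixedChar_ne_one hσ hχ
  have hmul : ∀ v y, mixedEmbedding.norm v = 1 →
      cutoffChar σ χ δ (v * y) = mixedChar σ χ v * cutoffChar σ χ δ y := by
    intro v y hv
    by_cases hy : mixedEmbedding.norm y = 0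
    · simp [cutoffChar, hy]
    · rw [cutoffChar, cutoffChar, mixedChar_mul σ χ (by simp [hv]) hy, map_mul, hv, one_mul]
      ring
  have hS : MeasurableSet {y : mixedSpace K | mixedEmbedding.norm y ≤ 1} :=
    measurableSet_le (mixedEmbedding.continuous_norm K).measurable measurable_const
  -- The set `normLeOne K` is the part of the cone where the norm is at most `1`. The indicator of
  -- that condition and the cutoff weight depend only on the norm, so they respect units and
  -- norm-one translations.
  have h := setIntegral_fundamentalCone_eq_zero μ
    (f := {y | mixedEmbedding.norm y ≤ 1}.indicator (cutoffChar σ χ δ)) ?_ hz hc ?_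
  · rwa [setIntegral_indicator hS] at h
  · intro u y
    simp only [Set.indicator, Set.mem_ofPred, norm_unit_smul]
    rw [unitSMul_smul, hmul _ _ (norm_unit u), mixedChar_unit, one_mul]
  · intro y
    simp only [Set.indicator, Set.mem_ofPred, map_mul, hz, one_mul]
    rw [hmul _ _ hz, mul_ite, mul_zero]

instance finite_intNorm_le (N : ℕ) : Finite {a : integerSet K // intNorm a ≤ N} := by
  have := (Ideal.finite_setOfPred_absNorm_le₀ (S := 𝓞 K) N).to_subtype
  refine Finite.of_injective (β := {I : (Ideal (𝓞 K))⁰ | Ideal.absNorm (I : Ideal (𝓞 K)) ≤ N} ×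
    torsion K) (fun a => (⟨(integerSetEquiv K a.1).1.1, ?_⟩, (integerSetEquiv K a.1).2)) ?_
  · change Ideal.absNorm ((integerSetEquiv K a.1).1 : Ideal (𝓞 K)) ≤ N
    rw [integerSetEquiv_apply_fst, Ideal.absNorm_span_singleton]
    exact a.2
  · intro a b h
    simp only [Prod.mk.injEq, Subtype.mk.injEq] at h
    exact Subtype.ext ((integerSetEquiv K).injective (Prod.ext (Subtype.ext h.1) h.2))

/-- The Haar measure on the mixed space for which the lattice of integers has covolume `1`. -/
noncomputable def latticeMeasure (K : Type*) [Field K] [NumberField K] :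
    Measure (mixedSpace K) :=
  (volume : Measure (Module.Free.ChooseBasisIndex ℤ (𝓞 K) → ℝ)).map
    (latticeBasis K).equivFun.symm

open scoped Classical in
instance : (latticeMeasure K).IsAddHaarMeasure :=
  (latticeBasis K).equivFunL.symm.isAddHaarMeasure_map volume

lemma equivFun_mem_span_iff {x : mixedSpace K} :
    (latticeBasis K).equivFun x ∈ Submodule.span ℤ
      (Set.range (Pi.basisFun ℝ (Module.Free.ChooseBasisIndex ℤ (𝓞 K)))) ↔
      x ∈ mixedEmbedding.integerLattice K := by
  rw [← mem_span_latticeBasis, Module.Basis.mem_span_iff_repr_mem,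
    Module.Basis.mem_span_iff_repr_mem]
  simp only [Pi.basisFun_repr, Module.Basis.equivFun_apply]

lemma inv_smul_mem_normLeOne_iff {n : ℕ} (hn : n ≠ 0) {y : mixedSpace K} :
    (n : ℝ)⁻¹ • y ∈ normLeOne K ↔
      y ∈ fundamentalCone K ∧ mixedEmbedding.norm y ≤ (n : ℝ) ^ Module.finrank ℚ K := by
  have hn' : (n : ℝ) ≠ 0 := by exact_mod_cast hn
  have h0 : 0 < (n : ℝ) ^ Module.finrank ℚ K := by positivity
  rw [mem_normLeOne, smul_mem_iff_mem (inv_ne_zero hn'), mixedEmbedding.norm_smul,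
    abs_of_nonneg (by positivity), inv_pow, inv_mul_le_iff₀ h0, mul_one]

/-- Points of the dilated lattice in `normLeOne K` correspond to points of `integerSet K` of bounded
norm. -/
noncomputable def latticePointEquiv {n : ℕ} (hn : n ≠ 0) :
    {a : integerSet K // intNorm a ≤ n ^ Module.finrank ℚ K} ≃
    ((latticeBasis K).equivFun '' normLeOne K ∩ (n : ℝ)⁻¹ •
      (Submodule.span ℤ (Set.range (Pi.basisFun ℝ (Module.Free.ChooseBasisIndex ℤ (𝓞 K)))) :
        Set (Module.Free.ChooseBasisIndex ℤ (𝓞 K) → ℝ)) : Set _) := by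
  have hn' : (n : ℝ) ≠ 0 := by exact_mod_cast hn
  refine Equiv.ofBijective (fun a => ⟨(latticeBasis K).equivFun ((n : ℝ)⁻¹ • (a.1 : mixedSpace K)),
    ⟨_, ?_, rfl⟩, ?_⟩) ⟨?_, ?_⟩
  · refine (inv_smul_mem_normLeOne_iff hn).2 ⟨a.1.2.1, ?_⟩
    rw [← intNorm_coe]
    exact_mod_cast a.2
  · rw [Set.mem_inv_smul_set_iff₀ hn', ← map_smul, smul_inv_smul₀ hn']
    exact equivFun_mem_span_iff.2 a.1.2.2
  · intro a b h
    have h1 := (latticeBasis K).equivFun.injective (congrArg Subtype.val h)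
    exact Subtype.ext (Subtype.ext (smul_right_injective _ (inv_ne_zero hn') h1))
  · rintro ⟨_, ⟨y, hy, rfl⟩, hy2⟩
    rw [Set.mem_inv_smul_set_iff₀ hn', ← map_smul] at hy2
    have hy3 := equivFun_mem_span_iff.1 hy2
    have hy4 : y = (n : ℝ)⁻¹ • ((n : ℝ) • y) := (inv_smul_smul₀ hn' y).symm
    rw [hy4, inv_smul_mem_normLeOne_iff hn] at hy
    refine ⟨⟨⟨(n : ℝ) • y, hy.1, hy3⟩, ?_⟩, Subtype.ext ?_⟩
    · have h := hy.2
      rw [← Nat.cast_le (α := ℝ), intNorm_coe]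
      exact_mod_cast h
    · exact congrArg (latticeBasis K).equivFun hy4.symm

lemma latticePointEquiv_apply {n : ℕ} (hn : n ≠ 0)
    (a : {a : integerSet K // intNorm a ≤ n ^ Module.finrank ℚ K}) :
    (latticeBasis K).equivFun.symm (latticePointEquiv hn a : _ → ℝ) =
      (n : ℝ)⁻¹ • (a.1 : mixedSpace K) :=
  (latticeBasis K).equivFun.symm_apply_apply _

lemma tendsto_tsum_integerSet_div_pow {f : mixedSpace K → ℝ} (hf : Continuous f) :
    Tendsto (fun n : ℕ => (∑' a : {a : integerSet K // intNorm a ≤ n ^ Module.finrank ℚ K},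
      f ((n : ℝ)⁻¹ • (a.1 : mixedSpace K))) / n ^ Module.finrank ℚ K) atTop
      (𝓝 (∫ y in normLeOne K, f y ∂(latticeMeasure K))) := by
  classical
  let e := (latticeBasis K).equivFun
  have he : Continuous e := LinearMap.continuous_of_finiteDimensional e.toLinearMap
  have he' : Continuous e.symm := LinearMap.continuous_of_finiteDimensional e.symm.toLinearMap
  let eh : mixedSpace K ≃ₜ _ := ⟨e.toEquiv, he, he'⟩
  have hb : Bornology.IsBounded (e '' normLeOne K) := by
    rw [← NormedSpace.isVonNBounded_iff ℝ]
    exact Bornology.IsVonNBounded.image ((NormedSpace.isVonNBounded_iff ℝ).2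
      (isBounded_normLeOne K)) (latticeBasis K).equivFunL.toContinuousLinearMap
  have hm : MeasurableSet (e '' normLeOne K) :=
    eh.toMeasurableEquiv.measurableSet_image.2 (measurableSet_normLeOne K)
  -- Any two Haar measures are mutually absolutely continuous, so the null frontier for `volume` is
  -- also null for `latticeMeasure K`.
  have hac : latticeMeasure K ≪ volume := Measure.absolutelyContinuous_isAddHaarMeasure _ _
  have hfr : volume (frontier (e '' normLeOne K)) = 0 := by
    have h1 : frontier (e '' normLeOne K) = e.symm ⁻¹' frontier (normLeOne K) :=
      (eh.image_frontier _).symm.trans (e.toEquiv.image_eq_preimage_symm _)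
    have h2 := hac (volume_frontier_normLeOne K)
    rwa [latticeMeasure, Measure.map_apply he'.measurable isClosed_frontier.measurableSet,
      ← h1] at h2
  have h := tendsto_tsum_div_pow_atTop_integral _ (f ∘ e.symm) (hf.comp he') hb hm hfr
  have hcard : Fintype.card (Module.Free.ChooseBasisIndex ℤ (𝓞 K)) = Module.finrank ℚ K := by
    rw [← Module.finrank_eq_card_chooseBasisIndex, RingOfIntegers.rank]
  have hint : ∫ x in e '' normLeOne K, (f ∘ e.symm) x =
      ∫ y in normLeOne K, f y ∂(latticeMeasure K) := by
    have h1 : e '' normLeOne K = e.symm ⁻¹' normLeOne K := e.toEquiv.image_eq_preimage_symm _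
    rw [h1]
    exact (eh.symm.measurableEmbedding.setIntegral_map f (normLeOne K)).symm
  rw [hint, hcard] at h
  refine h.congr' ?_
  filter_upwards [eventually_ne_atTop 0] with n hn
  congr 1
  rw [← (latticePointEquiv hn).tsum_eq]
  refine tsum_congr fun a => ?_
  rw [← latticePointEquiv_apply hn a]
  rfl

lemma tendsto_tsum_integerSet_div_pow_complex {f : mixedSpace K → ℂ} (hf : Continuous f) :
    Tendsto (fun n : ℕ => (∑' a : {a : integerSet K // intNorm a ≤ n ^ Module.finrank ℚ K},
      f ((n : ℝ)⁻¹ • (a.1 : mixedSpace K))) / (n : ℂ) ^ Module.finrank ℚ K) atTop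
      (𝓝 (∫ y in normLeOne K, f y ∂(latticeMeasure K))) := by
  classical
  have hre := tendsto_tsum_integerSet_div_pow (Complex.continuous_re.comp hf)
  have him := tendsto_tsum_integerSet_div_pow (Complex.continuous_im.comp hf)
  have hint : IntegrableOn f (normLeOne K) (latticeMeasure K) :=
    ((hf.continuousOn.integrableOn_compact
      (isBounded_normLeOne K).isCompact_closure).mono_set subset_closure)
  have h := ((Complex.continuous_ofReal.tendsto _).comp hre).add
    (((Complex.continuous_ofReal.tendsto _).comp him).mul_const Complex.I)
  convert! h using 2 with n
  · have := Fintype.ofFinite {a : integerSet K // intNorm a ≤ n ^ Module.finrank ℚ K}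
    simp only [Function.comp, tsum_fintype]
    push_cast
    rw [div_mul_eq_mul_div, ← add_div, Finset.sum_mul, ← Finset.sum_add_distrib]
    simp only [Complex.re_add_im]
  · exact (integral_re_add_im hint).symm

end CyclicNormOne

/-! ### From `d`-th powers to all bounds, and counting principal ideals. -/

namespace CyclicNormOne

open mixedEmbedding InfinitePlace Units MeasureTheory fundamentalCone
open scoped nonZeroDivisors

section Abstract

lemma tendsto_floor_root_pow_div {d : ℕ} (hd : d ≠ 0) :
    Tendsto (fun N : ℕ => ((⌊(N : ℝ) ^ (d : ℝ)⁻¹⌋₊ ^ d : ℕ) : ℝ) / N) atTop (𝓝 1) := by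
  have hd' : 0 < (d : ℝ)⁻¹ := by positivity
  have h1 : Tendsto (fun N : ℕ => (N : ℝ) ^ (d : ℝ)⁻¹) atTop atTop :=
    (tendsto_rpow_atTop hd').comp tendsto_natCast_atTop_atTop
  have h2 := ((tendsto_nat_floor_div_atTop (R := ℝ)).comp h1).pow d
  rw [one_pow] at h2
  refine h2.congr fun N => ?_
  simp only [Function.comp, div_pow]
  rw [Real.rpow_inv_natCast_pow (Nat.cast_nonneg _) hd]
  push_cast
  rfl

/-- A sequence with increments bounded by those of a sequence of linear growth is `o(N)` as soon as
it is so along `d`-th powers. -/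
lemma tendsto_div_of_tendsto_pow_div {d : ℕ} (hd : d ≠ 0) {A : ℕ → ℂ} {B : ℕ → ℝ} {b : ℝ}
    (hAB : ∀ M N, M ≤ N → ‖A N - A M‖ ≤ B N - B M)
    (hB : Tendsto (fun N : ℕ => B N / N) atTop (𝓝 b))
    (hA : Tendsto (fun n : ℕ => A (n ^ d) / (n : ℂ) ^ d) atTop (𝓝 0)) :
    Tendsto (fun N : ℕ => A N / N) atTop (𝓝 0) := by
  let m : ℕ → ℕ := fun N => ⌊(N : ℝ) ^ (d : ℝ)⁻¹⌋₊
  have hm : Tendsto m atTop atTop := tendsto_nat_floor_atTop.comp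
    ((tendsto_rpow_atTop (by positivity)).comp tendsto_natCast_atTop_atTop)
  have hmp : Tendsto (fun N => m N ^ d) atTop atTop := (tendsto_pow_atTop hd).comp hm
  have hr := tendsto_floor_root_pow_div hd
  have hle : ∀ N, m N ^ d ≤ N := by
    intro N
    have h1 : (m N : ℝ) ≤ (N : ℝ) ^ (d : ℝ)⁻¹ := Nat.floor_le (by positivity)
    have h2 := pow_le_pow_left₀ (Nat.cast_nonneg _) h1 d
    rw [Real.rpow_inv_natCast_pow (Nat.cast_nonneg _) hd] at h2
    exact_mod_cast h2
  -- Compare `N` with the largest `d`-th power `m ^ d ≤ N`. Since `m ^ d / N → 1`, the normalized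
  -- increment of `B` tends to `b - b * 1 = 0`.
  have hlim : Tendsto (fun N : ℕ => ‖A (m N ^ d) / ((m N : ℕ) : ℂ) ^ d‖ +
      (B N / N - B (m N ^ d) / ((m N ^ d : ℕ) : ℝ) * (((m N ^ d : ℕ) : ℝ) / N))) atTop (𝓝 0) := by
    have h1 := (hA.comp hm).norm
    have h2 := hB.sub ((hB.comp hmp).mul hr)
    simpa using h1.add h2
  refine squeeze_zero_norm' ?_ hlim
  filter_upwards [hmp.eventually_gt_atTop 0] with N hN
  have hN0 : 0 < N := hN.trans_le (hle N)
  have hN' : (0 : ℝ) < N := by exact_mod_cast hN0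
  have hm' : (0 : ℝ) < ((m N ^ d : ℕ) : ℝ) := by exact_mod_cast hN
  have hmle : ((m N ^ d : ℕ) : ℝ) ≤ N := by exact_mod_cast hle N
  have h1 : ‖A N‖ ≤ ‖A (m N ^ d)‖ + (B N - B (m N ^ d)) := by
    have := norm_add_le (A (m N ^ d)) (A N - A (m N ^ d))
    rw [add_sub_cancel] at this
    linarith [hAB _ _ (hle N)]
  have h2 : ‖A (m N ^ d) / ((m N : ℕ) : ℂ) ^ d‖ = ‖A (m N ^ d)‖ / ((m N ^ d : ℕ) : ℝ) := by
    rw [norm_div, norm_pow, Complex.norm_natCast]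
    push_cast
    rfl
  rw [h2, norm_div, Complex.norm_natCast, div_mul_div_cancel₀ hm'.ne']
  calc ‖A N‖ / N ≤ (‖A (m N ^ d)‖ + (B N - B (m N ^ d))) / N := by gcongr
    _ = ‖A (m N ^ d)‖ / N + (B N / N - B (m N ^ d) / N) := by ring
    _ ≤ _ := by gcongr

end Abstract

variable {K : Type*} [Field K] [NumberField K] [IsGalois ℚ K] {σ : K ≃ₐ[ℚ] K}
  (hσ : ∀ τ : K ≃ₐ[ℚ] K, τ ∈ Subgroup.zpowers σ)

/-- The sum of a function over the classes of height at most `N`. -/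
noncomputable def classSum (g : NormOneClass σ → ℂ) (N : ℕ) : ℂ :=
  ∑ c ∈ (finite_setOf_classHeight_le hσ N).toFinset, g c

/-- The norm of the ideal attached to a class and a positive rational integer. -/
noncomputable def pairNorm (p : NormOneClass σ × ℕ+) : ℕ :=
  classHeight σ p.1 * (p.2 : ℕ) ^ Module.finrank ℚ K

include hσ in
lemma finite_setOf_pairNorm_le (N : ℕ) : {p : NormOneClass σ × ℕ+ | pairNorm p ≤ N}.Finite := by
  -- Heights are positive, so the multiplier is at most `N`; the bound `N + 1` keeps it a positive
  -- integer when `N = 0`.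
  refine ((finite_setOf_classHeight_le hσ N).prod (Set.finite_Iic (N.succPNat))).subset ?_
  rintro ⟨c, n⟩ h
  have h0 := classHeight_pos hσ c
  have h1 : classHeight σ c * (n : ℕ) ^ Module.finrank ℚ K ≤ N := h
  have h2 : (n : ℕ) ≤ (n : ℕ) ^ Module.finrank ℚ K := Nat.le_self_pow Module.finrank_pos.ne' _
  have h3 := n.pos
  refine ⟨?_, ?_⟩
  · exact (Nat.le_mul_of_pos_right _ (h3.trans_le h2)).trans h1
  · change (n : ℕ) ≤ N + 1
    have := Nat.le_mul_of_pos_left ((n : ℕ) ^ Module.finrank ℚ K) h0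
    omega

/-- The pairs corresponding to principal ideals of norm at most `N`. -/
noncomputable def pairsBelow (N : ℕ) : Finset (NormOneClass σ × ℕ+) :=
  (finite_setOf_pairNorm_le hσ N).toFinset

lemma mem_pairsBelow {N : ℕ} {p : NormOneClass σ × ℕ+} :
    p ∈ pairsBelow hσ N ↔ pairNorm p ≤ N := by
  simp [pairsBelow]

/-- For fixed `n`, the condition `h * n ^ d ≤ N` says that `h` is at most the integer quotient `N /
n ^ d`, and positivity of `h` forces `n ≤ N`. This is the shape required for Möbius inversion. -/
lemma sum_pairsBelow (g : NormOneClass σ → ℂ) (N : ℕ) :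
    ∑ p ∈ pairsBelow hσ N, g p.1 =
      ∑ n ∈ Finset.Icc 1 N, classSum hσ g (N / n ^ Module.finrank ℚ K) := by
  simp only [classSum]
  rw [Finset.sum_sigma']
  refine Finset.sum_bij' (fun p _ => ⟨p.2, p.1⟩) (fun x _ => (x.2, Nat.toPNat' x.1))
    ?_ ?_ ?_ ?_ ?_
  · rintro ⟨c, n⟩ h
    rw [mem_pairsBelow, pairNorm] at h
    have h0 := classHeight_pos hσ c
    have h2 : (n : ℕ) ≤ (n : ℕ) ^ Module.finrank ℚ K := Nat.le_self_pow Module.finrank_pos.ne' _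
    have h3 := n.pos
    have := Nat.le_mul_of_pos_left ((n : ℕ) ^ Module.finrank ℚ K) h0
    simp only [Finset.mem_sigma, Finset.mem_Icc, Set.Finite.mem_toFinset, Set.mem_ofPred]
    refine ⟨⟨h3, by simp only at h; omega⟩, ?_⟩
    exact (Nat.le_div_iff_mul_le (h3.trans_le h2)).2 h
  · rintro ⟨n, c⟩ h
    simp only [Finset.mem_sigma, Finset.mem_Icc, Set.Finite.mem_toFinset, Set.mem_ofPred] at h
    rw [mem_pairsBelow, pairNorm]
    have h3 : 0 < n := h.1.1
    simp only [Nat.toPNat'_coe, h3, if_true]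
    exact (Nat.le_div_iff_mul_le (by positivity)).1 h.2
  · rintro ⟨c, n⟩ _
    simp
  · rintro ⟨n, c⟩ h
    simp only [Finset.mem_sigma, Finset.mem_Icc] at h
    have h3 : 0 < n := h.1.1
    simp [Nat.toPNat'_coe, h3]
  · intros
    rfl

/-- Integers of bounded norm in the fundamental cone correspond to pairs and roots of unity. -/
noncomputable def intNormLeEquiv (N : ℕ) :
    {a : integerSet K // intNorm a ≤ N} ≃ {p // p ∈ pairsBelow hσ N} × torsion K :=
  ((integerSetEquivClass hσ).subtypeEquiv fun a => by
    rw [mem_pairsBelow, pairNorm, ← intNorm_eq hσ]).trans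
    (Equiv.prodSubtypeFstEquivSubtypeProd (p := fun p => p ∈ pairsBelow hσ N))

lemma tsum_intNorm_le (N : ℕ) (g : ℕ → NormOneClass σ → ℂ) :
    ∑' a : {a : integerSet K // intNorm a ≤ N},
      g (intNorm a.1) (intClass σ (nonZeroDivisors.coe_ne_zero (preimageOfMemIntegerSet a.1))) =
      torsionOrder K * ∑ p ∈ pairsBelow hσ N, g (pairNorm p) p.1 := by
  have h : ∀ a : {a : integerSet K // intNorm a ≤ N},
      g (intNorm a.1) (intClass σ (nonZeroDivisors.coe_ne_zero (preimageOfMemIntegerSet a.1))) =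
      g (pairNorm (intNormLeEquiv hσ N a).1.1) (intNormLeEquiv hσ N a).1.1.1 := by
    intro a
    rw [intClass_preimageOfMemIntegerSet hσ, intNorm_eq hσ]
    rfl
  simp_rw [h]
  have : Fintype (torsion K) := Fintype.ofFinite _
  rw [(intNormLeEquiv hσ N).tsum_eq (fun q => g (pairNorm q.1.1) q.1.1.1), tsum_fintype,
    Fintype.sum_prod_type_right]
  simp only [Finset.sum_const, Finset.card_univ, nsmul_eq_mul]
  rw [torsionOrder, Nat.card_eq_fintype_card, Finset.sum_coe_sort _ (fun p => g (pairNorm p) p.1)]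

/-- Principal ideals are those of trivial ideal class, so their count is given by the ideal-counting
asymptotics for a single class. -/
lemma card_pairsBelow (N : ℕ) : (pairsBelow hσ N).card =
    Nat.card {I : (Ideal (𝓞 K))⁰ // (Ideal.absNorm (I : Ideal (𝓞 K)) : ℝ) ≤ (N : ℝ) ∧
      ClassGroup.mk0 I = 1} := by
  rw [← Fintype.card_coe, ← Nat.card_eq_fintype_card]
  refine Nat.card_congr ?_
  refine ((multipleIdealEquiv hσ).subtypeEquiv
    (q := fun I => Ideal.absNorm (I.1 : Ideal (𝓞 K)) ≤ N) fun p => ?_).trans ?_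
  · rw [absNorm_multipleIdealEquiv, mem_pairsBelow, pairNorm]
  · refine (Equiv.subtypeSubtypeEquivSubtypeInter
      (fun I : (Ideal (𝓞 K))⁰ => Submodule.IsPrincipal (I : Ideal (𝓞 K)))
      (fun I => Ideal.absNorm (I : Ideal (𝓞 K)) ≤ N)).trans (Equiv.subtypeEquivRight fun I => ?_)
    rw [← ClassGroup.mk0_eq_one_iff I.2, Nat.cast_le, and_comm]

/-- The number of principal ideals of norm at most `N` grows linearly. -/
lemma exists_tendsto_card_pairsBelow_div : ∃ b : ℝ, b ≠ 0 ∧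
    Tendsto (fun N : ℕ => ((pairsBelow hσ N).card : ℝ) / N) atTop (𝓝 b) := by
  refine ⟨_, ?_, ((NumberField.Ideal.tendsto_norm_le_and_mk_eq_div_atTop K 1).comp
    tendsto_natCast_atTop_atTop).congr fun N => ?_⟩
  · have h1 := (regulator_pos K).ne'
    have h2 : (torsionOrder K : ℝ) ≠ 0 := by exact_mod_cast torsionOrder_ne_zero K
    have h3 : Real.sqrt |discr K| ≠ 0 := by
      rw [Real.sqrt_ne_zero (by positivity), abs_ne_zero]
      exact_mod_cast discr_ne_zero K
    have := Real.pi_pos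
    positivity
  · simp only [Function.comp]
    rw [card_pairsBelow]

end CyclicNormOne

/-! ### Cancellation in character sums and the limit of the averages. -/

namespace CyclicNormOne

open mixedEmbedding InfinitePlace Units MeasureTheory fundamentalCone
open scoped nonZeroDivisors

variable {K : Type*} [Field K] [NumberField K] {σ : K ≃ₐ[ℚ] K}
  {χ : AddChar (Torus K) Circle}

lemma cutoffChar_inv_smul {n : ℕ} (hn : n ≠ 0) (δ : ℝ) (a : integerSet K) :
    cutoffChar σ χ δ ((n : ℝ)⁻¹ • (a : mixedSpace K)) =
      (min ((intNorm a : ℝ) / n ^ Module.finrank ℚ K / δ) 1 : ℝ) *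
        χ (classTilde σ (intClass σ (nonZeroDivisors.coe_ne_zero (preimageOfMemIntegerSet a)))) := by
  have hn' : (n : ℝ)⁻¹ ≠ 0 := inv_ne_zero (by exact_mod_cast hn)
  rw [cutoffChar, mixedChar_smul σ χ a.2.1.2 hn', mixedEmbedding.norm_smul, ← intNorm_coe,
    ← mixedChar_mixedEmbedding, mixedEmbedding_preimageOfMemIntegerSet,
    abs_of_nonneg (by positivity), inv_pow, inv_mul_eq_div]

/-- In degree one there is a single archimedean place, so `ker Σ` and the torus are trivial. -/
lemma two_le_finrank_of_ne_one (hχ1 : χ ≠ 1) : 2 ≤ Module.finrank ℚ K := by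
  by_contra! h
  have h1 : Module.finrank ℚ K = 1 := by
    have := Module.finrank_pos (R := ℚ) (M := K)
    omega
  have hcard : Fintype.card (InfinitePlace K) ≤ 1 := by
    have h2 := card_add_two_mul_card_eq_rank K
    have h3 := card_eq_nrRealPlaces_add_nrComplexPlaces K
    omega
  refine hχ1 (DFunLike.ext _ _ fun t => ?_)
  obtain ⟨x, rfl⟩ := QuotientAddGroup.mk'_surjective (logUnits K) t
  have hx : x = 0 := by
    ext w
    have h4 := (mem_kerSum _).1 x.2
    have := Fintype.card_le_one_iff_subsingleton.1 hcard
    rwa [Fintype.sum_subsingleton _ w] at h4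
  rw [hx, map_zero]
  exact (AddChar.map_zero_eq_one χ).trans rfl

lemma classesBelow_eq {r : ℝ} (hr : 0 < r) :
    classesBelow σ r = {c | classHeight σ c ≤ ⌈r⌉₊ - 1} := by
  ext c
  -- Positivity makes the truncated subtraction `⌈r⌉₊ - 1` genuine, so the strict bound `r` becomes
  -- a non-strict integer bound.
  have h : 0 < ⌈r⌉₊ := Nat.ceil_pos.2 hr
  rw [classesBelow, Set.mem_ofPred, Set.mem_ofPred, ← Nat.lt_ceil]
  omega

instance : IsProbabilityMeasure (haarTorus K) :=
  ⟨Measure.addHaarMeasure_self (K₀ := (⊤ : TopologicalSpace.PositiveCompacts (Torus K)))⟩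

/-- Translation by `s` with `χ s ≠ 1` multiplies the invariant integral by `χ s`. -/
lemma integral_char_eq_zero (hχ1 : χ ≠ 1) : ∫ t, (χ t : ℂ) ∂(haarTorus K) = 0 := by
  obtain ⟨s, hs⟩ : ∃ s, χ s ≠ 1 := by
    by_contra! h
    exact hχ1 (DFunLike.ext _ _ h)
  have hinv : (haarTorus K).IsAddLeftInvariant := by
    unfold haarTorus
    infer_instance
  have h := integral_add_left_eq_self (μ := haarTorus K) (fun t => (χ t : ℂ)) s
  simp_rw [AddChar.map_add_eq_mul, Circle.coe_mul, integral_const_mul] at h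
  have h2 : ((χ s : ℂ) - 1) * ∫ t, (χ t : ℂ) ∂(haarTorus K) = 0 := by linear_combination h
  exact (mul_eq_zero.1 h2).resolve_left (sub_ne_zero.2 fun h => hs (Circle.coe_eq_one.1 h))

variable [IsGalois ℚ K] (hσ : ∀ τ : K ≃ₐ[ℚ] K, τ ∈ Subgroup.zpowers σ)

lemma tendsto_sum_pairsBelow_cutoff (hχ : Continuous χ) (hχ1 : χ ≠ 1) (δ : ℝ) :
    Tendsto (fun n : ℕ => (∑ p ∈ pairsBelow hσ (n ^ Module.finrank ℚ K),
      ((min ((pairNorm p : ℝ) / n ^ Module.finrank ℚ K / δ) 1 : ℝ) : ℂ) * χ (classTilde σ p.1)) /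
        (n : ℂ) ^ Module.finrank ℚ K) atTop (𝓝 0) := by
  have h := tendsto_tsum_integerSet_div_pow_complex (continuous_cutoffChar σ hχ δ)
  rw [setIntegral_cutoffChar_eq_zero hσ hχ1] at h
  have hw : (torsionOrder K : ℂ) ≠ 0 := by exact_mod_cast torsionOrder_ne_zero K
  have h2 := h.const_mul ((torsionOrder K : ℂ)⁻¹)
  rw [mul_zero] at h2
  refine h2.congr' ?_
  filter_upwards [eventually_ne_atTop 0] with n hn
  simp_rw [cutoffChar_inv_smul hn δ]
  rw [tsum_intNorm_le hσ _ (fun k c => ((min ((k : ℝ) / n ^ Module.finrank ℚ K / δ) 1 : ℝ) : ℂ) *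
    χ (classTilde σ c)), mul_div_assoc, inv_mul_cancel_left₀ hw]

/-- The character sum over principal ideals of norm at most `nᵈ` is `o(nᵈ)`. -/
lemma tendsto_sum_pairsBelow_pow (hχ : Continuous χ) (hχ1 : χ ≠ 1) :
    Tendsto (fun n : ℕ => (∑ p ∈ pairsBelow hσ (n ^ Module.finrank ℚ K),
      (χ (classTilde σ p.1) : ℂ)) / (n : ℂ) ^ Module.finrank ℚ K) atTop (𝓝 0) := by
  obtain ⟨b, -, hb⟩ := exists_tendsto_card_pairsBelow_div hσ
  obtain ⟨B, hB⟩ := (Metric.isBounded_range_of_tendsto _ hb).exists_norm_le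
  have hB0 : 0 ≤ B := (norm_nonneg _).trans (hB _ ⟨0, rfl⟩)
  have hcard : ∀ N : ℕ, ((pairsBelow hσ N).card : ℝ) ≤ B * N := by
    intro N
    rcases Nat.eq_zero_or_pos N with rfl | hN
    · have : pairsBelow hσ 0 = ∅ := by
        refine Finset.eq_empty_of_forall_notMem fun p hp => ?_
        rw [mem_pairsBelow, pairNorm] at hp
        have := Nat.mul_pos (classHeight_pos hσ p.1) (Nat.pow_pos (n := Module.finrank ℚ K) p.2.pos)
        omega
      simp [this]
    · have := (le_abs_self _).trans (hB _ ⟨N, rfl⟩)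
      rwa [div_le_iff₀ (by exact_mod_cast hN)] at this
  rw [Metric.tendsto_atTop]
  intro ε hε
  -- The cutoff affects only pairs of norm at most `δ * n ^ d`, of which there are at most `B * δ *
  -- n ^ d`. This `δ` makes the loss at most `ε / 2 * n ^ d`; `B + 1` avoids dividing by zero.
  let δ : ℝ := ε / (2 * (B + 1))
  have hδ : 0 < δ := by positivity
  have hBδ : B * δ ≤ ε / 2 := by
    have : (B + 1) * δ = ε / 2 := by
      simp only [δ]
      field_simp
    nlinarith
  obtain ⟨n₀, hn₀⟩ := Metric.tendsto_atTop.1 (tendsto_sum_pairsBelow_cutoff hσ hχ hχ1 δ)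
    (ε / 2) (by positivity)
  refine ⟨max n₀ 1, fun n hn => ?_⟩
  have hn1 : 0 < n := (le_max_right _ _).trans hn
  have h1 := hn₀ n ((le_max_left _ _).trans hn)
  have hnd : (0 : ℝ) < (n : ℝ) ^ Module.finrank ℚ K := by positivity
  rw [dist_zero_right, norm_div, norm_pow, Complex.norm_natCast] at h1 ⊢
  set S := pairsBelow hσ (n ^ Module.finrank ℚ K)
  set w : NormOneClass σ × ℕ+ → ℝ := fun p =>
    min ((pairNorm p : ℝ) / n ^ Module.finrank ℚ K / δ) 1
  classical
  have hdiff : ‖∑ p ∈ S, (χ (classTilde σ p.1) : ℂ) -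
      ∑ p ∈ S, (w p : ℂ) * χ (classTilde σ p.1)‖ ≤ B * (δ * n ^ Module.finrank ℚ K) := by
    rw [← Finset.sum_sub_distrib]
    calc _ ≤ ∑ p ∈ S, (if p ∈ pairsBelow hσ ⌊δ * (n : ℝ) ^ Module.finrank ℚ K⌋₊ then (1 : ℝ)
          else 0) := by
          refine norm_sum_le_of_le _ fun p _ => ?_
          have hfac : (χ (classTilde σ p.1) : ℂ) - (w p : ℂ) * χ (classTilde σ p.1) =
              ((1 - w p : ℝ) : ℂ) * χ (classTilde σ p.1) := by
            push_cast
            ring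
          rw [hfac, norm_mul, Circle.norm_coe, mul_one, Complex.norm_real]
          have hw0 : 0 ≤ w p := le_min (by positivity) zero_le_one
          have hw1 : w p ≤ 1 := min_le_right _ _
          rw [Real.norm_of_nonneg (by linarith)]
          split_ifs with hp
          · linarith
          · rw [mem_pairsBelow, not_le, Nat.floor_lt (by positivity)] at hp
            have : w p = 1 := by
              refine min_eq_right ?_
              rw [le_div_iff₀ hδ, le_div_iff₀ hnd, one_mul]
              exact hp.le
            linarith
      _ ≤ ((pairsBelow hσ ⌊δ * (n : ℝ) ^ Module.finrank ℚ K⌋₊).card : ℝ) := by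
          rw [← Finset.sum_filter, Finset.sum_const, nsmul_eq_mul, mul_one]
          exact_mod_cast Finset.card_le_card fun p hp => (Finset.mem_filter.1 hp).2
      _ ≤ B * (⌊δ * (n : ℝ) ^ Module.finrank ℚ K⌋₊ : ℝ) := hcard _
      _ ≤ _ := by
          gcongr
          exact Nat.floor_le (by positivity)
  rw [div_lt_iff₀ hnd] at h1 ⊢
  have h2 := norm_le_norm_add_norm_sub (∑ p ∈ S, (w p : ℂ) * χ (classTilde σ p.1))
    (∑ p ∈ S, (χ (classTilde σ p.1) : ℂ))
  have h3 : B * (δ * (n : ℝ) ^ Module.finrank ℚ K) ≤ ε / 2 * (n : ℝ) ^ Module.finrank ℚ K := by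
    rw [← mul_assoc]
    gcongr
  rw [norm_sub_rev] at h2
  have h4 : ε * (n : ℝ) ^ Module.finrank ℚ K = ε / 2 * (n : ℝ) ^ Module.finrank ℚ K +
      ε / 2 * (n : ℝ) ^ Module.finrank ℚ K := by ring
  replace h1 : ‖∑ p ∈ S, (w p : ℂ) * χ (classTilde σ p.1)‖ <
      ε / 2 * (n : ℝ) ^ Module.finrank ℚ K := h1
  linarith

/-- The character sum over principal ideals of norm at most `N` is `o(N)`. -/
lemma tendsto_sum_pairsBelow_div (hχ : Continuous χ) (hχ1 : χ ≠ 1) :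
    Tendsto (fun N : ℕ => (∑ p ∈ pairsBelow hσ N, (χ (classTilde σ p.1) : ℂ)) / N)
      atTop (𝓝 0) := by
  obtain ⟨b, -, hb⟩ := exists_tendsto_card_pairsBelow_div hσ
  refine tendsto_div_of_tendsto_pow_div (d := Module.finrank ℚ K) Module.finrank_pos.ne'
    (A := fun N => ∑ p ∈ pairsBelow hσ N, (χ (classTilde σ p.1) : ℂ)) ?_ hb
    (tendsto_sum_pairsBelow_pow hσ hχ hχ1)
  intro M N hMN
  classical
  have hsub : pairsBelow hσ M ⊆ pairsBelow hσ N := fun p hp => by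
    rw [mem_pairsBelow] at hp ⊢
    exact hp.trans hMN
  -- The increment of the character sum has one term of modulus one for each new pair, so it is
  -- bounded by the increment of the count.
  rw [← Finset.sum_sdiff hsub, add_sub_cancel_right, ← Nat.cast_sub (Finset.card_le_card hsub),
    ← Finset.card_sdiff_of_subset hsub]
  refine (norm_sum_le_of_le _ fun p _ => (Circle.norm_coe _).le).trans (le_of_eq ?_)
  rw [Finset.sum_const, nsmul_eq_mul, mul_one]

lemma classSum_zero (g : NormOneClass σ → ℂ) : classSum hσ g 0 = 0 := by
  refine Finset.sum_eq_zero fun c hc => ?_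
  have h := classHeight_pos hσ c
  rw [Set.Finite.mem_toFinset, Set.mem_ofPred] at hc
  omega

/-- The average of a non-trivial character over the classes of height at most `N` tends to `0`. -/
lemma tendsto_classSum_div_classSum_one (hχ : Continuous χ) (hχ1 : χ ≠ 1) :
    Tendsto (fun N : ℕ => classSum hσ (fun c => (χ (classTilde σ c) : ℂ)) N /
      classSum hσ (fun _ => 1) N) atTop (𝓝 0) := by
  have hd := two_le_finrank_of_ne_one (K := K) hχ1
  obtain ⟨b, hb0, hb⟩ := exists_tendsto_card_pairsBelow_div hσ
  have h1 := tendsto_div_of_sum_div_pow hd (classSum_zero hσ _)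
    (fun N => sum_pairsBelow hσ (fun c => (χ (classTilde σ c) : ℂ)) N)
    (tendsto_sum_pairsBelow_div hσ hχ hχ1)
  have h2 := tendsto_div_of_sum_div_pow hd (classSum_zero hσ _)
    (fun N => sum_pairsBelow hσ (fun _ => 1) N) (a := (b : ℂ)) (by
      refine ((Complex.continuous_ofReal.tendsto _).comp hb).congr fun N => ?_
      simp)
  -- Both class sums are divided by `N`; the limit `b * moebiusSeries d` of the denominator is
  -- non-zero.
  have h3 := h1.div h2 (mul_ne_zero (by exact_mod_cast hb0) (moebiusSeries_ne_zero hd))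
  rw [zero_mul, zero_div] at h3
  refine h3.congr' ?_
  filter_upwards [eventually_ne_atTop 0] with N hN
  exact div_div_div_cancel_right₀ (by exact_mod_cast hN) _ _

include hσ in
lemma finite_classesBelow (r : ℝ) : (classesBelow σ r).Finite := by
  rcases le_or_gt r 0 with hr | hr
  · convert! Set.finite_empty
    refine Set.eq_empty_of_forall_notMem fun c hc => ?_
    have : (classHeight σ c : ℝ) < r := hc
    have h0 : (0 : ℝ) ≤ classHeight σ c := Nat.cast_nonneg _
    linarith
  · rw [classesBelow_eq hr]
    exact finite_setOf_classHeight_le hσ _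

lemma average_eq {r : ℝ} (hr : 0 < r) :
    average σ χ r = classSum hσ (fun c => (χ (classTilde σ c) : ℂ)) (⌈r⌉₊ - 1) /
      classSum hσ (fun _ => 1) (⌈r⌉₊ - 1) := by
  have hfin := finite_setOf_classHeight_le hσ (⌈r⌉₊ - 1)
  rw [average, classesBelow_eq hr, finsum_mem_eq_finite_toFinset_sum _ hfin,
    Set.ncard_eq_toFinset_card _ hfin]
  simp [classSum]

include hσ in
lemma tendsto_average_zero (hχ : Continuous χ) (hχ1 : χ ≠ 1) :
    Tendsto (average σ χ) atTop (𝓝 0) := by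
  have h1 : Tendsto (fun r : ℝ => ⌈r⌉₊ - 1) atTop atTop :=
    (tendsto_sub_atTop_nat 1).comp tendsto_nat_ceil_atTop
  refine ((tendsto_classSum_div_classSum_one hσ hχ hχ1).comp h1).congr' ?_
  filter_upwards [eventually_gt_atTop 0] with r hr
  exact (average_eq hσ hr).symm

include hσ in
lemma tendsto_average_one :
    Tendsto (average σ (1 : AddChar (Torus K) Circle)) atTop (𝓝 1) := by
  refine tendsto_const_nhds.congr' ?_
  -- Once `r` exceeds the height of the trivial class the average is over a non-empty set and equals
  -- `1`; on an empty set it would be `0 / 0 = 0`.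
  let c₀ : NormOneClass σ := 1
  filter_upwards [eventually_gt_atTop (classHeight σ c₀ : ℝ)] with r hr
  have hfin := finite_classesBelow hσ r
  have hne : (classesBelow σ r).ncard ≠ 0 := Set.ncard_ne_zero_of_mem (a := c₀) hr hfin
  rw [average, finsum_mem_eq_finite_toFinset_sum _ hfin]
  simp only [AddChar.one_apply, Circle.coe_one, Finset.sum_const, nsmul_eq_mul, mul_one]
  rw [← Set.ncard_eq_toFinset_card _ hfin, div_self (by exact_mod_cast hne)]

end CyclicNormOne

theorem mainTheorem1 (K : Type*) [Field K] [NumberField K] [IsGalois ℚ K]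
    (σ : K ≃ₐ[ℚ] K) (hσ : ∀ τ : K ≃ₐ[ℚ] K, τ ∈ Subgroup.zpowers σ) :
    (∀ β : CyclicNormOne.normOne K, ∃ α : 𝓞 K, CyclicNormOne.IsVisiblePoint σ β α) ∧
    (∀ r : ℝ, (CyclicNormOne.classesBelow σ r).Finite) ∧
    (∀ χ : AddChar (CyclicNormOne.Torus K) Circle, Continuous χ →
      Tendsto (CyclicNormOne.average σ χ) atTop
        (𝓝 (∫ t, (χ t : ℂ) ∂(CyclicNormOne.haarTorus K)))) ∧
    (∀ χ : AddChar (CyclicNormOne.Torus K) Circle, Continuous χ → χ ≠ 1 →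
      Tendsto (CyclicNormOne.average σ χ) atTop (𝓝 0)) := by
  refine ⟨CyclicNormOne.exists_isVisiblePoint hσ, CyclicNormOne.finite_classesBelow hσ,
    fun χ hχ => ?_, fun χ hχ hχ1 => CyclicNormOne.tendsto_average_zero hσ hχ hχ1⟩
  by_cases hχ1 : χ = 1
  · subst hχ1
    have h : ∫ t, ((1 : AddChar (CyclicNormOne.Torus K) Circle) t : ℂ)
        ∂(CyclicNormOne.haarTorus K) = 1 := by simp
    rw [h]
    exact CyclicNormOne.tendsto_average_one hσ
  · rw [CyclicNormOne.integral_char_eq_zero hχ1]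
    exact CyclicNormOne.tendsto_average_zero hσ hχ hχ1
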